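/- Let $k\ge 0$ and let $\mathcal U_k$ be the monoid of uniform block permutations, i.e. set partitions $d$ of $[k]\cup[\bar k]$ each of whose blocks has as many elements in $[k]$ as in $[\bar k]$; the product $dd'$ stacks $d$ on top of $d'$, takes connected components and deletes the middle row. Let $\mathsf{top}(d)$ and $\mathsf{bot}(d)$ be the set partitions of $[k]$ induced by $d$ on the top and bottom rows. For a set partition $\pi$ of $[k]$ let $e_\pi$ be the idempotent with blocks $A\cup\bar A$ ($A\in\pi$), let $G_{e_\pi}=\{d:\mathsf{top}(d)=\mathsf{bot}(d)=\pi\}$ be the maximal subgroup at $e_\pi$, and let $L_\pi=\{d:\mathsf{bot}(d)=\pi\}$ be the $\mathscr L$-class of $e_\pi$. Let $I_k$ be the set of $k$-tuples $\vec\lambda=(\lambda^{(1)},\dots,\lambda^{(k)})$ of integer partitions with $\sum_i i|\lambda^{(i)}|=k$, and let $\mathsf{type}(\vec\lambda)=(1^{a_1}2^{a_2}\cdots k^{a_k})\vdash k$ with $a_i=|\lambda^{(i)}|$. For partitions of the same integer write $\lambda<_{\rm rl}\mu$ if $\lambda_i>\mu_i$ at the first $i$ where they differ. Order $I_k$ totally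 by: $\vec\lambda<\vec\mu$ if $\mathsf{type}(\vec\lambda)<_{\rm rl}\mathsf{type}(\vec\mu)$, or if the types agree and $\lambda^{(i)}<_{\rm rl}\mu^{(i)}$ at the first $i$ with $\lambda^{(i)}\ne\mu^{(i)}$. For $\lambda=(1^{a_1}2^{a_2}\cdots)\vdash k$ let $\pi_\lambda$ cut $1,2,\dots,k$ into $a_1$ consecutive intervals of length $1$, followed by $a_2$ intervals of length $2$, and so on; write $G_\lambda=G_{e_{\pi_\lambda}}$ and $L_\lambda=L_{\pi_\lambda}$. An element $g$ of $G_{e_\pi}$ permutes the blocks of $\pi$ of each size $i$; its cycle type is the tuple in $I_k$ whose $i$-th component is the cycle type of that permutation. Let $d_{\vec\mu}\in G_{\mathsf{type}(\vec\mu)}$ be the representative of cycle type $\vec\mu$ that permutes the blocks of size $i$, taken in increasing order, in consecutive cycles of lengths $\mu^{(i)}_1,\mu^{(i)}_2,\dots$. For $\vec\lambda\in I_k$ with $\lambda=\mathsf{type}(\vec\lambda)$, let $V^{\vec\lambda}$ be the irreducible representation of $G_\lambda$ obtained as the tensor product over $i$ of the Specht modules indexed by $\lambda^{(i)}$ of the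 symmetric groups on the blocks of $\pi_\lambda$ of size $i$, and let $W^{\vec\lambda}=\mathbb C L_\lambda\otimes_{\mathbb CG_\lambda}V^{\vec\lambda}$ be the irreducible representation of $\mathcal U_k$ on which $d$ acts by $d(\ell\otimes v)=d\ell\otimes v$ if $d\ell\in L_\lambda$ and $d(\ell\otimes v)=0$ otherwise. Define $I_k\times I_k$ matrices as follows. * $X_k$ is the character table of $\mathcal U_k$: $(X_k)_{\vec\lambda,\vec\mu}=\chi_{W^{\vec\lambda}}(d_{\vec\mu})$. * $A_k$ consists of the character tables of the maximal subgroups: $(A_k)_{\vec\lambda,\vec\mu}=\chi_{V^{\vec\lambda}}(d_{\vec\mu})$ if $\mathsf{type}(\vec\lambda)=\mathsf{type}(\vec\mu)$, and $0$ otherwise. * $B_k$ has in row $\vec\nu$ and column $\vec\mu$ the entry $$b_{\vec\mu}^{\vec\nu}=\Big\langle \frac{\mathbf p_{\vec\nu}[\mathbf E]}{\mathbf z_{\vec\nu}},\ \mathbf p_{\vec\mu}[\mathbf X]\Big\rangle .$$ Here, in the polynomial ring $\mathbb C[p_i[X_j]: i,j\ge1]$, $\mathbf p_{\vec\mu}[\mathbf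 X]=\prod_j\prod_{r\in\mu^{(j)}}p_r[X_j]$ (the inner product is over the parts of $\mu^{(j)}$ with multiplicity); $\mathbf z_{\vec\mu}=\prod_j z_{\mu^{(j)}}$ with $z_{(1^{a_1}2^{a_2}\cdots)}=\prod_i i^{a_i}a_i!$; $\langle\ ,\ \rangle$ is the bilinear form with $\langle\mathbf p_{\vec\lambda}[\mathbf X],\mathbf p_{\vec\mu}[\mathbf X]\rangle=\delta_{\vec\lambda,\vec\mu}\mathbf z_{\vec\mu}$; $E_r=\sum_{\vec\mu\in I_r}\mathbf p_{\vec\mu}[\mathbf X]/\mathbf z_{\vec\mu}$; $p_m[f]$ is obtained from $f$ by replacing every $p_r[X_j]$ by $p_{mr}[X_j]$; and $\mathbf p_{\vec\nu}[\mathbf E]=\prod_j\prod_{r\in\nu^{(j)}}p_r[E_j]$. Then: $A_k$ is block diagonal, i.e. $(A_k)_{\vec\lambda,\vec\mu}=0$ whenever $\mathsf{type}(\vec\lambda)\neq\mathsf{type}(\vec\mu)$; $B_k$ is upper unitriangular with respect to the total order on $I_k$; the entries of $B_k$ are nonnegative integers, namely $$b^{\vec\nu}_{\vec\mu}=\#\{d\in\mathcal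 U_k:\ d_{\vec\mu}\le d,\ \mathsf{top}(d)=\mathsf{bot}(d),\ d\text{ has cycle type }\vec\nu\},$$ where $d_{\vec\mu}\le d$ means that every block of $d_{\vec\mu}$ is contained in a block of $d$; and $$X_k=A_k\,B_k .$$ -/

import Mathlib

namespace UBP

noncomputable section

open scoped Classical

/-! ### Uniform block permutations -/

/-- A uniform block permutation: a set partition of `[k] ∪ [k̄]` (`Sum.inl a` is the top vertex `a`,
`Sum.inr b` is the bottom vertex `b̄`) all of whose blocks contain as many top as bottom vertices. -/
@[ext]
structure U (k : ℕ) where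
  rel : Setoid (Fin k ⊕ Fin k)
  uniform : ∀ x, {a | rel x (Sum.inl a)}.ncard = {b | rel x (Sum.inr b)}.ncard

/-- The two-row diagrams stacked on top of each other, as a set partition of the three rows. -/
def stack {k : ℕ} (r s : Setoid (Fin k ⊕ Fin k)) : Setoid (Fin k ⊕ Fin k ⊕ Fin k) :=
  r.map (Sum.map id Sum.inl) ⊔ s.map Sum.inr

/-- Diagram product: connected components of the stacked diagram, with the middle row removed. -/
def relMul {k : ℕ} (r s : Setoid (Fin k ⊕ Fin k)) : Setoid (Fin k ⊕ Fin k) :=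
  (stack r s).comap (Sum.map id Sum.inr)

/-- `top d`: the set partition of `[k]` cut out by the blocks of `d` in the top row. -/
def U.top {k : ℕ} (d : U k) : Setoid (Fin k) := d.rel.comap Sum.inl

/-- `bot d`: the set partition of `[k]` cut out by the blocks of `d` in the bottom row. -/
def U.bot {k : ℕ} (d : U k) : Setoid (Fin k) := d.rel.comap Sum.inr

/-! Auxiliary facts, used to see that `U k` is a monoid. -/

/-- The top set `S` and the bottom set `T` together form a union of blocks. -/
def Sat {k : ℕ} (r : Setoid (Fin k ⊕ Fin k)) (S T : Set (Fin k)) : Prop :=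
  ∀ x y, r x y → (Sum.elim S T x ↔ Sum.elim S T y)

theorem sat_relMul {k : ℕ} (r s : Setoid (Fin k ⊕ Fin k)) (S T : Set (Fin k)) :
    Sat (relMul r s) S T ↔ ∃ M, Sat r S M ∧ Sat s M T := by
  constructor
  · intro h
    let P : Fin k ⊕ Fin k ⊕ Fin k → Prop := fun z =>
      ∃ p : Fin k ⊕ Fin k, stack r s (Sum.map id Sum.inr p) z ∧ Sum.elim S T p
    have hP : ∀ p : Fin k ⊕ Fin k, P (Sum.map id Sum.inr p) ↔ Sum.elim S T p := by
      intro p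
      constructor
      · rintro ⟨q, hq, hS⟩
        exact (h q p hq).1 hS
      · intro hp
        exact ⟨p, (stack r s).refl' _, hp⟩
    have hinv : ∀ z w, stack r s z w → (P z ↔ P w) := by
      intro z w hzw
      constructor
      · rintro ⟨p, hp, hS⟩
        exact ⟨p, (stack r s).trans' hp hzw, hS⟩
      · rintro ⟨p, hp, hS⟩
        exact ⟨p, (stack r s).trans' hp ((stack r s).symm' hzw), hS⟩
    refine ⟨fun m => P (Sum.inr (Sum.inl m)), ?_, ?_⟩
    · intro x y hxy
      have h1 : stack r s (Sum.map id Sum.inl x) (Sum.map id Sum.inl y) :=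
        (le_sup_left : r.map (Sum.map id Sum.inl) ≤ stack r s)
          (Relation.EqvGen.rel _ _ ⟨x, y, hxy, rfl, rfl⟩)
      have h2 : ∀ x : Fin k ⊕ Fin k, P (Sum.map id Sum.inl x) ↔
          Sum.elim S (fun m => P (Sum.inr (Sum.inl m))) x := by
        rintro (a | m)
        · exact hP (Sum.inl a)
        · exact Iff.rfl
      rw [← h2, ← h2]
      exact hinv _ _ h1
    · intro x y hxy
      have h1 : stack r s (Sum.inr x) (Sum.inr y) :=
        (le_sup_right : s.map Sum.inr ≤ stack r s)
          (Relation.EqvGen.rel _ _ ⟨x, y, hxy, rfl, rfl⟩)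
      have h2 : ∀ x : Fin k ⊕ Fin k, P (Sum.inr x) ↔
          Sum.elim (fun m => P (Sum.inr (Sum.inl m))) T x := by
        rintro (m | b)
        · exact Iff.rfl
        · exact hP (Sum.inr b)
      rw [← h2, ← h2]
      exact hinv _ _ h1
  · rintro ⟨M, h1, h2⟩ x y hxy
    let g : Fin k ⊕ Fin k ⊕ Fin k → Prop := Sum.elim S (Sum.elim M T)
    have hle : stack r s ≤ Setoid.ker g := by
      refine sup_le ?_ ?_
      · refine Setoid.eqvGen_le ?_
        rintro _ _ ⟨p, q, hpq, rfl, rfl⟩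
        have := h1 p q hpq
        have e : ∀ p : Fin k ⊕ Fin k, g (Sum.map id Sum.inl p) = Sum.elim S M p := by
          rintro (a | a) <;> rfl
        rw [Setoid.ker_def, e, e]
        exact propext this
      · refine Setoid.eqvGen_le ?_
        rintro _ _ ⟨p, q, hpq, rfl, rfl⟩
        exact propext (h2 p q hpq)
    have e : ∀ p : Fin k ⊕ Fin k, g (Sum.map id Sum.inr p) = Sum.elim S T p := by
      rintro (a | a) <;> rfl
    have := hle hxy
    rw [Setoid.ker_def, e, e] at this
    exact this.to_iff

theorem rel_ext {k : ℕ} {r s : Setoid (Fin k ⊕ Fin k)}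
    (h : ∀ S T, Sat r S T ↔ Sat s S T) : r = s := by
  have key : ∀ {r s : Setoid (Fin k ⊕ Fin k)}, (∀ S T, Sat s S T → Sat r S T) →
      ∀ x y, r x y → s x y := by
    intro r s h x y hxy
    have e : Sum.elim (fun a => s x (Sum.inl a)) (fun b => s x (Sum.inr b)) = s x := by
      funext p
      rcases p with p | p <;> rfl
    have hs : Sat s (fun a => s x (Sum.inl a)) (fun b => s x (Sum.inr b)) := by
      intro p q hpq
      rw [e]
      exact ⟨fun hp => s.trans' hp hpq, fun hq => s.trans' hq (s.symm' hpq)⟩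
    have := h _ _ hs x y hxy
    rw [e] at this
    exact this.1 (s.refl' x)
  ext x y
  exact ⟨key (fun S T => (h S T).2) x y, key (fun S T => (h S T).1) x y⟩

theorem Sat.ncard_eq {k : ℕ} (d : U k) {S T : Set (Fin k)} (h : Sat d.rel S T) :
    S.ncard = T.ncard := by
  rw [Set.ncard_eq_toFinset_card' S, Set.ncard_eq_toFinset_card' T,
    Finset.card_eq_sum_card_fiberwise (f := fun a => (Quotient.mk d.rel (Sum.inl a)))
      (t := Finset.univ) (fun _ _ => Finset.mem_coe.2 (Finset.mem_univ _)),
    Finset.card_eq_sum_card_fiberwise (s := T.toFinset)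
      (f := fun a => (Quotient.mk d.rel (Sum.inr a)))
      (t := Finset.univ) (fun _ _ => Finset.mem_coe.2 (Finset.mem_univ _))]
  refine Finset.sum_congr rfl ?_
  intro q _
  induction q using Quotient.inductionOn with
  | h x =>
    by_cases hx : Sum.elim S T x
    · have hu := d.uniform x
      rw [Set.ncard_eq_toFinset_card', Set.ncard_eq_toFinset_card'] at hu
      convert hu using 2
      · ext a
        simp only [Finset.mem_filter, Set.mem_toFinset, Set.mem_ofPred_eq]
        constructor
        · rintro ⟨_, h2⟩
          exact d.rel.symm' (Quotient.exact h2)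
        · intro h2
          exact ⟨(h _ _ h2).1 hx, Quotient.sound (d.rel.symm' h2)⟩
      · ext a
        simp only [Finset.mem_filter, Set.mem_toFinset, Set.mem_ofPred_eq]
        constructor
        · rintro ⟨_, h2⟩
          exact d.rel.symm' (Quotient.exact h2)
        · intro h2
          exact ⟨(h _ _ h2).1 hx, Quotient.sound (d.rel.symm' h2)⟩
    · rw [Finset.filter_false_of_mem, Finset.filter_false_of_mem]
      · intro a ha h2
        exact hx ((h _ _ (Quotient.exact h2)).1 (Set.mem_toFinset.1 ha))
      · intro a ha h2
        exact hx ((h _ _ (Quotient.exact h2)).1 (Set.mem_toFinset.1 ha))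

theorem uniform_of_sat {k : ℕ} {r : Setoid (Fin k ⊕ Fin k)}
    (h : ∀ S T : Set (Fin k), Sat r S T → S.ncard = T.ncard) (x : Fin k ⊕ Fin k) :
    {a | r x (Sum.inl a)}.ncard = {b | r x (Sum.inr b)}.ncard := by
  refine h _ _ ?_
  have e : Sum.elim {a | r x (Sum.inl a)} {b | r x (Sum.inr b)} = r x := by
    funext p
    rcases p with p | p <;> rfl
  intro p q hpq
  rw [e]
  exact ⟨fun hp => r.trans' hp hpq, fun hq => r.trans' hq (r.symm' hpq)⟩

/-- The idempotent `e_π`, with blocks `A ∪ Ā` for the blocks `A` of `π`. -/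
def idem {k : ℕ} (π : Setoid (Fin k)) : U k where
  rel := π.comap (Sum.elim id id)
  uniform _ := rfl

/-- The reflected diagram. -/
def flip {k : ℕ} (d : U k) : U k where
  rel := d.rel.comap Sum.swap
  uniform x := (d.uniform x.swap).symm

theorem sat_idem {k : ℕ} (π : Setoid (Fin k)) (S T : Set (Fin k)) :
    Sat (idem π).rel S T ↔ S = T ∧ ∀ a b, π a b → (a ∈ S ↔ b ∈ S) := by
  constructor
  · intro h
    have hST : S = T := by
      ext a
      exact h (Sum.inl a) (Sum.inr a) (π.refl' a)
    exact ⟨hST, fun a b hab => h (Sum.inl a) (Sum.inl b) hab⟩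
  · rintro ⟨rfl, h⟩ (a | a) (b | b) hab <;> exact h a b hab

/-- The product of diagrams, and the identity diagram with blocks `{a, ā}`. -/
instance {k : ℕ} : Mul (U k) where
  mul d e :=
    { rel := relMul d.rel e.rel
      uniform := uniform_of_sat (by
        intro S T h
        obtain ⟨M, h1, h2⟩ := (sat_relMul _ _ _ _).1 h
        exact (Sat.ncard_eq d h1).trans (Sat.ncard_eq e h2)) }

instance {k : ℕ} : One (U k) := ⟨idem ⊥⟩

theorem sat_mul {k : ℕ} (d e : U k) (S T : Set (Fin k)) :
    Sat (d * e).rel S T ↔ ∃ M, Sat d.rel S M ∧ Sat e.rel M T :=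
  sat_relMul d.rel e.rel S T

theorem U.ext_sat {k : ℕ} {d e : U k} (h : ∀ S T, Sat d.rel S T ↔ Sat e.rel S T) : d = e :=
  U.ext (rel_ext h)

theorem sat_one {k : ℕ} (S T : Set (Fin k)) : Sat (1 : U k).rel S T ↔ S = T := by
  refine (sat_idem ⊥ S T).trans ⟨fun h => h.1, fun h => ⟨h, ?_⟩⟩
  rintro a b hab
  have : a = b := hab
  rw [this]

instance {k : ℕ} : Monoid (U k) where
  mul_assoc a b c := by
    refine U.ext_sat fun S T => ?_
    simp only [sat_mul]
    constructor
    · rintro ⟨M, ⟨N, h1, h2⟩, h3⟩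
      exact ⟨N, h1, M, h2, h3⟩
    · rintro ⟨N, h1, M, h2, h3⟩
      exact ⟨M, ⟨N, h1, h2⟩, h3⟩
  one_mul a := by
    refine U.ext_sat fun S T => ?_
    simp only [sat_mul, sat_one]
    exact ⟨fun ⟨M, h, h2⟩ => h ▸ h2, fun h => ⟨S, rfl, h⟩⟩
  mul_one a := by
    refine U.ext_sat fun S T => ?_
    simp only [sat_mul, sat_one]
    exact ⟨fun ⟨M, h2, h⟩ => h ▸ h2, fun h => ⟨T, h, rfl⟩⟩

theorem exists_bot {k : ℕ} (d : U k) (a : Fin k) : ∃ b, d.rel (Sum.inl a) (Sum.inr b) := by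
  have h : ({b | d.rel (Sum.inl a) (Sum.inr b)} : Set (Fin k)).ncard ≠ 0 := by
    rw [← d.uniform]
    exact (Set.ncard_pos (Set.toFinite _)).2 ⟨a, d.rel.refl' _⟩ |>.ne'
  obtain ⟨b, hb⟩ := Set.nonempty_of_ncard_ne_zero h
  exact ⟨b, hb⟩

theorem exists_top {k : ℕ} (d : U k) (b : Fin k) : ∃ a, d.rel (Sum.inl a) (Sum.inr b) := by
  obtain ⟨a, ha⟩ := exists_bot (flip d) b
  exact ⟨a, d.rel.symm' ha⟩

/-- The union of the top halves of the blocks of `d` whose bottom half meets `T`. On blocks of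
`bot d` this is the inverse of the size-preserving bijection `top d → bot d`. -/
def topMap {k : ℕ} (d : U k) (T : Set (Fin k)) : Set (Fin k) :=
  {a | ∃ b ∈ T, d.rel (Sum.inl a) (Sum.inr b)}

theorem sat_iff {k : ℕ} (d : U k) (S T : Set (Fin k)) :
    Sat d.rel S T ↔ S = topMap d T ∧ ∀ b c, d.bot b c → (b ∈ T ↔ c ∈ T) := by
  constructor
  · intro h
    refine ⟨?_, fun b c hbc => h (Sum.inr b) (Sum.inr c) hbc⟩
    ext a
    constructor
    · intro ha
      obtain ⟨b, hb⟩ := exists_bot d a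
      exact ⟨b, (h _ _ hb).1 ha, hb⟩
    · rintro ⟨b, hb, hab⟩
      exact (h _ _ hab).2 hb
  · rintro ⟨rfl, h⟩
    have h1 : ∀ a b, d.rel (Sum.inl a) (Sum.inr b) → (a ∈ topMap d T ↔ b ∈ T) := by
      intro a b hab
      constructor
      · rintro ⟨c, hc, hac⟩
        exact (h c b (d.rel.trans' (d.rel.symm' hac) hab)).1 hc
      · intro hb
        exact ⟨b, hb, hab⟩
    rintro (a | a) (b | b) hab
    · obtain ⟨c, hc⟩ := exists_bot d a
      exact (h1 a c hc).trans (h1 b c (d.rel.trans' (d.rel.symm' hab) hc)).symm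
    · exact h1 a b hab
    · exact (h1 b a (d.rel.symm' hab)).symm
    · exact h a b hab

theorem sat_flip {k : ℕ} (d : U k) (S T : Set (Fin k)) :
    Sat (flip d).rel S T ↔ Sat d.rel T S := by
  have e : ∀ (S T : Set (Fin k)) x, Sum.elim S T x ↔ Sum.elim T S x.swap := by
    rintro S T (x | x) <;> rfl
  constructor
  · intro h x y hxy
    have hxy2 : (flip d).rel x.swap y.swap := by
      change d.rel x.swap.swap y.swap.swap
      rwa [Sum.swap_swap, Sum.swap_swap]
    have := h x.swap y.swap hxy2
    rw [e, e T S y]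
    exact this
  · intro h x y hxy
    rw [e, e S T y]
    exact h _ _ hxy

theorem sat_top {k : ℕ} (d : U k) (S : Set (Fin k)) :
    (∃ T, Sat d.rel S T) ↔ ∀ a b, d.top a b → (a ∈ S ↔ b ∈ S) := by
  constructor
  · rintro ⟨T, h⟩ a b hab
    exact h (Sum.inl a) (Sum.inl b) hab
  · intro h
    exact ⟨topMap (flip d) S, (sat_flip d _ _).1 ((sat_iff (flip d) _ _).2 ⟨rfl, h⟩)⟩

theorem sat_bot {k : ℕ} (d : U k) (T : Set (Fin k)) :
    (∃ S, Sat d.rel S T) ↔ ∀ a b, d.bot a b → (a ∈ T ↔ b ∈ T) := by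
  simp only [← sat_flip d]
  exact sat_top (flip d) T

theorem setoid_ext_sat {k : ℕ} {r s : Setoid (Fin k)}
    (h : ∀ S : Set (Fin k), (∀ a b, r a b → (a ∈ S ↔ b ∈ S)) ↔ (∀ a b, s a b → (a ∈ S ↔ b ∈ S))) :
    r = s := by
  have key : ∀ (r : Setoid (Fin k)) x, ∀ a b, r a b → (a ∈ {y | r x y} ↔ b ∈ {y | r x y}) :=
    fun r x a b hab => ⟨fun hp => r.trans' hp hab, fun hq => r.trans' hq (r.symm' hab)⟩
  ext x y
  exact ⟨fun hxy => ((h _).2 (key s x) x y hxy).1 (s.refl' x),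
    fun hxy => ((h _).1 (key r x) x y hxy).1 (r.refl' x)⟩

theorem top_mul {k : ℕ} {d e : U k} (h : d.bot = e.top) : (d * e).top = d.top := by
  refine setoid_ext_sat fun S => ?_
  rw [← sat_top, ← sat_top]
  constructor
  · rintro ⟨T, hT⟩
    obtain ⟨M, h1, _⟩ := (sat_mul _ _ _ _).1 hT
    exact ⟨M, h1⟩
  · rintro ⟨M, hM⟩
    have := (sat_bot d M).1 ⟨S, hM⟩
    rw [h, ← sat_top] at this
    obtain ⟨T, hT⟩ := this
    exact ⟨T, (sat_mul _ _ _ _).2 ⟨M, hM, hT⟩⟩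

theorem bot_mul {k : ℕ} {d e : U k} (h : d.bot = e.top) : (d * e).bot = e.bot := by
  refine setoid_ext_sat fun S => ?_
  rw [← sat_bot, ← sat_bot]
  constructor
  · rintro ⟨T, hT⟩
    obtain ⟨M, _, h1⟩ := (sat_mul _ _ _ _).1 hT
    exact ⟨M, h1⟩
  · rintro ⟨M, hM⟩
    have := (sat_top e M).1 ⟨S, hM⟩
    rw [← h, ← sat_bot] at this
    obtain ⟨T, hT⟩ := this
    exact ⟨T, (sat_mul _ _ _ _).2 ⟨M, hT, hM⟩⟩

theorem le_bot_mul {k : ℕ} (d e : U k) : e.bot ≤ (d * e).bot := by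
  intro x y hxy
  have key := (sat_bot (d * e) {z | (d * e).bot x z}).2 (fun a b hab =>
    ⟨fun hp => (d * e).bot.trans' hp hab,
      fun hq => (d * e).bot.trans' hq ((d * e).bot.symm' hab)⟩)
  obtain ⟨S, hS⟩ := key
  obtain ⟨M, _, h1⟩ := (sat_mul _ _ _ _).1 hS
  exact (h1 (Sum.inr x) (Sum.inr y) hxy).1 ((d * e).bot.refl' x)

theorem idem_mul {k : ℕ} (d : U k) : idem d.top * d = d := by
  refine U.ext_sat fun S T => ?_
  simp only [sat_mul, sat_idem]
  exact ⟨fun ⟨M, ⟨h, _⟩, h2⟩ => h ▸ h2, fun h => ⟨S, ⟨rfl, (sat_top d S).1 ⟨T, h⟩⟩, h⟩⟩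

theorem mul_idem {k : ℕ} (d : U k) : d * idem d.bot = d := by
  refine U.ext_sat fun S T => ?_
  simp only [sat_mul, sat_idem]
  constructor
  · rintro ⟨M, h2, h, _⟩
    exact h ▸ h2
  · intro h
    exact ⟨T, h, rfl, (sat_bot d T).1 ⟨S, h⟩⟩

theorem flip_mul {k : ℕ} (d : U k) : flip d * d = idem d.bot := by
  refine U.ext_sat fun S T => ?_
  simp only [sat_mul, sat_idem, sat_flip]
  constructor
  · rintro ⟨M, h1, h2⟩
    refine ⟨?_, (sat_bot d S).1 ⟨M, h1⟩⟩
    ext b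
    obtain ⟨a, ha⟩ := exists_top d b
    exact (h1 _ _ ha).symm.trans (h2 _ _ ha)
  · rintro ⟨rfl, h⟩
    obtain ⟨M, hM⟩ := (sat_bot d S).2 h
    exact ⟨M, hM, hM⟩

/-! ### Maximal subgroups and Schützenberger representations -/

/-- The maximal subgroup of `U k` at the idempotent `e_π`. -/
abbrev G {k : ℕ} (π : Setoid (Fin k)) : Type := {d : U k // d.top = π ∧ d.bot = π}

instance {k : ℕ} (π : Setoid (Fin k)) : Group (G π) where
  mul g h := ⟨g.1 * h.1, (top_mul (g.2.2.trans h.2.1.symm)).trans g.2.1,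
    (bot_mul (g.2.2.trans h.2.1.symm)).trans h.2.2⟩
  one := ⟨idem π, rfl, rfl⟩
  inv g := ⟨flip g.1, g.2.2, g.2.1⟩
  mul_assoc a b c := Subtype.ext (mul_assoc a.1 b.1 c.1)
  one_mul a := Subtype.ext (by
    have h := idem_mul a.1
    rw [a.2.1] at h
    exact h)
  mul_one a := Subtype.ext (by
    have h := mul_idem a.1
    rw [a.2.2] at h
    exact h)
  inv_mul_cancel a := Subtype.ext (by
    have h := flip_mul a.1
    rw [a.2.2] at h
    exact h)

/-- The `𝓛`-class of the idempotent `e_π`. -/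
abbrev L {k : ℕ} (π : Setoid (Fin k)) : Type := {d : U k // d.bot = π}

/-- The right action of the maximal subgroup on the `𝓛`-class. -/
def act {k : ℕ} {π : Setoid (Fin k)} (l : L π) (g : G π) : L π :=
  ⟨l.1 * g.1, (bot_mul (l.2.trans g.2.1.symm)).trans g.2.2⟩

section Induced

variable {k : ℕ} {π : Setoid (Fin k)} {V : Type} [AddCommGroup V] [Module ℂ V]
  (ρ : Representation ℂ (G π) V)

/-- The relations `ℓ g ⊗ v = ℓ ⊗ g v` in `ℂ L ⊗ V = (L →₀ V)`. -/
def tensorRel : Submodule ℂ (L π →₀ V) :=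
  Submodule.span ℂ {x | ∃ (l : L π) (g : G π) (v : V),
    x = Finsupp.single (act l g) v - Finsupp.single l (ρ g v)}

/-- `ℂ L ⊗ V` over the group algebra of the maximal subgroup. -/
abbrev Ind : Type := (L π →₀ V) ⧸ tensorRel ρ

/-- The action of `m ∈ U k` on `ℂ L ⊗ V` (tensor product over `ℂ`): `ℓ ⊗ v` is sent to `m ℓ ⊗ v` if
`m ℓ` is in `L`, and to `0` otherwise. -/
def preAct (π : Setoid (Fin k)) (V : Type) [AddCommGroup V] [Module ℂ V] (m : U k) :
    (L π →₀ V) →ₗ[ℂ] (L π →₀ V) :=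
  Finsupp.lsum ℂ fun l : L π =>
    if h : (m * l.1).bot = π then Finsupp.lsingle (⟨m * l.1, h⟩ : L π) else 0

theorem preAct_single (m : U k) (l : L π) (v : V) :
    preAct π V m (Finsupp.single l v) =
      if h : (m * l.1).bot = π then Finsupp.single (⟨m * l.1, h⟩ : L π) v else 0 := by
  unfold preAct
  rw [Finsupp.lsum_single]
  split_ifs <;> rfl

theorem bot_mul_act (m : U k) (l : L π) (g : G π) :
    (m * (act l g).1).bot = π ↔ (m * l.1).bot = π := by
  have e : m * (act l g).1 = (m * l.1) * g.1 := (mul_assoc m l.1 g.1).symm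
  have e2 : m * l.1 = (m * (act l g).1) * (g⁻¹).1 := by
    rw [e, mul_assoc]
    have h1 : g.1 * (g⁻¹).1 = idem π := congrArg Subtype.val (mul_inv_cancel g)
    have h2 := mul_idem l.1
    rw [l.2] at h2
    rw [h1, mul_assoc, h2]
  constructor
  · intro h
    rw [e2, bot_mul (h.trans (g⁻¹).2.1.symm)]
    exact (g⁻¹).2.2
  · intro h
    rw [e, bot_mul (h.trans g.2.1.symm)]
    exact g.2.2

theorem preAct_le (m : U k) : tensorRel ρ ≤ (tensorRel ρ).comap (preAct π V m) := by
  refine Submodule.span_le.2 ?_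
  rintro _ ⟨l, g, v, rfl⟩
  rw [SetLike.mem_coe, Submodule.mem_comap, map_sub, preAct_single, preAct_single]
  by_cases h : (m * l.1).bot = π
  · rw [dif_pos h, dif_pos ((bot_mul_act m l g).2 h)]
    refine Submodule.subset_span ⟨⟨m * l.1, h⟩, g, v, ?_⟩
    congr 2
    exact Subtype.ext (mul_assoc m l.1 g.1).symm
  · rw [dif_neg h, dif_neg (fun h2 => h ((bot_mul_act m l g).1 h2)), sub_zero]
    exact Submodule.zero_mem _

/-- The representation `ℂ L ⊗ V` of `U k` induced from the representation `V` of the maximal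
subgroup. -/
def indRep : Representation ℂ (U k) (Ind ρ) where
  toFun m := (tensorRel ρ).mapQ (tensorRel ρ) (preAct π V m) (preAct_le ρ m)
  map_one' := by
    refine Submodule.linearMap_qext _ (Finsupp.lhom_ext fun l v => ?_)
    have h : ((1 : U k) * l.1).bot = π := by rw [one_mul]; exact l.2
    have e : (⟨1 * l.1, h⟩ : L π) = l := Subtype.ext (one_mul l.1)
    simp only [LinearMap.comp_apply, Submodule.mkQ_apply, Submodule.mapQ_apply, Module.End.one_apply]
    rw [preAct_single, dif_pos h, e]
  map_mul' m n := by
    refine Submodule.linearMap_qext _ (Finsupp.lhom_ext fun l v => ?_)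
    simp only [LinearMap.comp_apply, Submodule.mkQ_apply, Submodule.mapQ_apply, Module.End.mul_apply]
    congr 1
    rw [preAct_single, preAct_single]
    by_cases h : (n * l.1).bot = π
    · rw [dif_pos h, preAct_single]
      simp only [mul_assoc]
    · rw [dif_neg h, dif_neg, map_zero]
      intro h2
      apply h
      refine le_antisymm ?_ ?_
      · rw [mul_assoc] at h2
        exact (le_bot_mul m (n * l.1)).trans h2.le
      · have := le_bot_mul n l.1
        rwa [l.2] at this

end Induced

/-! ### Blocks and the permutation of the blocks given by an element of a maximal subgroup -/

/-- The blocks of size `i + 1` of the set partition `π`. -/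
abbrev Block {k : ℕ} (π : Setoid (Fin k)) (i : Fin k) : Type :=
  {B : Set (Fin k) // B ∈ π.classes ∧ B.ncard = i + 1}

instance {k : ℕ} (π : Setoid (Fin k)) (i : Fin k) : Fintype (Block π i) :=
  inferInstanceAs (Fintype {B : Set (Fin k) // B ∈ π.classes ∧ B.ncard = i + 1})

theorem sat_block {k : ℕ} {π : Setoid (Fin k)} {B : Set (Fin k)} (g : G π) (hB : B ∈ π.classes) :
    Sat g.1.rel (topMap g.1 B) B := by
  refine (sat_iff _ _ _).2 ⟨rfl, ?_⟩
  obtain ⟨y, rfl⟩ := hB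
  rw [g.2.2]
  exact fun a b hab => ⟨fun hp => π.trans' (π.symm' hab) hp, fun hq => π.trans' hab hq⟩

theorem topMap_mem {k : ℕ} {π : Setoid (Fin k)} {B : Set (Fin k)} (g : G π)
    (hB : B ∈ π.classes) : topMap g.1 B ∈ π.classes := by
  have hs := sat_block g hB
  obtain ⟨y, rfl⟩ := hB
  obtain ⟨a, ha⟩ := exists_top g.1 y
  refine ⟨a, ?_⟩
  ext x
  constructor
  · rintro ⟨b, hb, hxb⟩
    have hb2 : g.1.bot b y := by rw [g.2.2]; exact hb
    have : g.1.top x a := g.1.rel.trans' hxb (g.1.rel.trans' hb2 (g.1.rel.symm' ha))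
    rwa [g.2.1] at this
  · intro hx
    have hx2 : g.1.top x a := by rw [g.2.1]; exact hx
    exact ⟨y, π.refl' y, g.1.rel.trans' hx2 ha⟩

/-- An element `g` of the maximal subgroup permutes the blocks of each size; products of diagrams are
read from top to bottom, so that `g` acts from the left by the bijection from bottom blocks to top
blocks. -/
instance {k : ℕ} (π : Setoid (Fin k)) (i : Fin k) : MulAction (G π) (Block π i) where
  smul g B := ⟨topMap g.1 B.1, topMap_mem g B.2.1,
    (Sat.ncard_eq g.1 (sat_block g B.2.1)).trans B.2.2⟩
  one_smul B := Subtype.ext (by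
    have h := sat_block (1 : G π) B.2.1
    exact ((sat_idem π _ _).1 h).1)
  mul_smul g h B := Subtype.ext (by
    have h1 := sat_block h B.2.1
    have h2 := sat_block g (topMap_mem h B.2.1)
    have h3 : Sat (g * h).1.rel (topMap g.1 (topMap h.1 B.1)) B.1 :=
      (sat_mul g.1 h.1 _ _).2 ⟨_, h2, h1⟩
    exact ((sat_iff _ _ _).1 h3).1.symm)

/-- The permutation of the blocks of size `i + 1`. -/
def blockPerm {k : ℕ} (π : Setoid (Fin k)) (i : Fin k) : G π →* Equiv.Perm (Block π i) :=
  MulAction.toPermHom (G π) (Block π i)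

/-! ### Specht modules -/

section Specht

/-- The parts of a partition, in nonincreasing order. -/
def rows {n : ℕ} (p : n.Partition) : List ℕ := p.parts.sort (· ≥ ·)

/-- The cells of the Young diagram: `⟨r, c⟩` is the cell in row `r` and column `c`. -/
abbrev Cells {n : ℕ} (p : n.Partition) : Type := Σ r : Fin (rows p).length, Fin ((rows p).get r)

variable {n : ℕ} (p : n.Partition) (α : Type) [Fintype α]

/-- A filling of the Young diagram in which each element of `α` occurs exactly once. -/
abbrev Tableau : Type := Cells p ≃ α

variable {p α}

/-- The tabloid of a tableau, recorded by the function which gives the row of each entry. -/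
def tabloid (t : Tableau p α) : α → ℕ := fun a => (t.symm a).1

/-- The column of an entry of a tableau. -/
def column (t : Tableau p α) : α → ℕ := fun a => (t.symm a).2

/-- The polytabloid `∑ sgn(σ) σ{t}`, over the permutations `σ` which preserve the columns of `t`. -/
def polytabloid (t : Tableau p α) : (α → ℕ) →₀ ℂ :=
  ∑ σ : Equiv.Perm α with (∀ a, column t (σ a) = column t a),
    Finsupp.single (tabloid (t.trans σ)) ((Equiv.Perm.sign σ : ℤ) : ℂ)

variable (p α)

/-- The permutation representation of the symmetric group on row functions. -/
def rowRep : Representation ℂ (Equiv.Perm α) ((α → ℕ) →₀ ℂ) where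
  toFun τ := Finsupp.lmapDomain ℂ ℂ (fun f => f ∘ τ.symm)
  map_one' := by
    refine Finsupp.lhom_ext fun f c => ?_
    simp [Finsupp.mapDomain_single]
    rfl
  map_mul' σ τ := by
    refine Finsupp.lhom_ext fun f c => ?_
    simp [Finsupp.mapDomain_single]
    rfl

/-- The span of the polytabloids. -/
def spechtSubmodule : Submodule ℂ ((α → ℕ) →₀ ℂ) :=
  Submodule.span ℂ (Set.range (polytabloid : Tableau p α → (α → ℕ) →₀ ℂ))

theorem rowRep_polytabloid (t : Tableau p α) (τ : Equiv.Perm α) :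
    rowRep α τ (polytabloid t) = polytabloid (t.trans τ) := by
  unfold polytabloid
  rw [map_sum]
  refine Finset.sum_equiv (MulAut.conj τ).toEquiv ?_ ?_
  · intro σ
    simp only [Finset.mem_filter, Finset.mem_univ, true_and]
    have e : ∀ b, column (t.trans τ) (τ b) = column t b := by
      intro b
      have e2 : (t.trans τ).symm (τ b) = t.symm b := by
        rw [Equiv.symm_apply_eq]
        simp
      unfold column
      rw [e2]
    have e3 : ∀ b, (MulAut.conj τ).toEquiv σ (τ b) = τ (σ b) := by
      intro b
      change τ (σ (τ⁻¹ (τ b))) = τ (σ b)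
      exact congrArg (fun x => τ (σ x)) (τ.symm_apply_apply b)
    constructor
    · intro h a
      obtain ⟨b, rfl⟩ := τ.surjective a
      rw [e3, e, e, h]
    · intro h a
      have := h (τ a)
      rwa [e3, e, e] at this
  · intro σ _
    have e : tabloid (t.trans σ) ∘ τ.symm =
        tabloid ((t.trans τ).trans ((MulAut.conj τ) σ)) := by
      funext a
      have e2 : ((t.trans τ).trans ((MulAut.conj τ) σ)).symm a = (t.trans σ).symm (τ.symm a) := by
        rw [Equiv.symm_apply_eq]
        simp [MulAut.conj_apply]
      simp only [tabloid, Function.comp_apply, e2]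
    simp only [rowRep, MonoidHom.coe_mk, OneHom.coe_mk, Finsupp.lmapDomain_apply,
      Finsupp.mapDomain_single, MulEquiv.toEquiv_eq_coe, MulEquiv.coe_toEquiv]
    rw [e]
    congr 2
    rw [MulAut.conj_apply, Equiv.Perm.sign_mul, Equiv.Perm.sign_mul, Equiv.Perm.sign_inv,
      mul_right_comm, Int.units_mul_self, one_mul]

/-- The Specht module: the span of the polytabloids. -/
def Specht : Type := spechtSubmodule p α

instance : AddCommGroup (Specht p α) := inferInstanceAs (AddCommGroup (spechtSubmodule p α))

instance : Module ℂ (Specht p α) := inferInstanceAs (Module ℂ (spechtSubmodule p α))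

/-- The Specht module as a representation of the symmetric group of `α`. -/
def spechtRep : Representation ℂ (Equiv.Perm α) (Specht p α) :=
  Representation.subrepresentation (rowRep α) (spechtSubmodule p α) (by
    intro τ
    refine Submodule.span_le.2 ?_
    rintro _ ⟨t, rfl⟩
    rw [SetLike.mem_coe, Submodule.mem_comap, rowRep_polytabloid]
    exact Submodule.subset_span ⟨_, rfl⟩)

end Specht

/-! ### The index set `I k` -/

/-- A partition of an unspecified nonnegative integer, the first component. -/
abbrev Ptn : Type := Σ n : ℕ, n.Partition

/-- `I k`: sequences `(λ⁽¹⁾, …, λ⁽ᵏ⁾)` of partitions with `∑ i |λ⁽ⁱ⁾| = k`; the partition `λ⁽ⁱ⁺¹⁾` is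
stored at the index `i : Fin k`. -/
abbrev I (k : ℕ) : Type := {v : Fin k → Ptn // ∑ i, (v i).1 * ((i : ℕ) + 1) = k}

/-- Partitions of `k` in exponential notation `(1^{a₁} 2^{a₂} ⋯ k^{aₖ})`; the multiplicity of the part
`i + 1` is stored at the index `i : Fin k`. -/
abbrev ExpPtn (k : ℕ) : Type := {a : Fin k → ℕ // ∑ i, a i * ((i : ℕ) + 1) = k}

/-- The partition `(1^{a₁} ⋯ k^{aₖ})`, where `aᵢ = |λ⁽ⁱ⁾|`. -/
def type {k : ℕ} (v : I k) : ExpPtn k := ⟨fun i => (v.1 i).1, v.2⟩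

instance {k : ℕ} : Finite (I k) := by
  have hb : ∀ (v : I k) (i : Fin k), (v.1 i).1 < k + 1 := by
    intro v i
    have h1 : (v.1 i).1 * ((i : ℕ) + 1) ≤ k := by
      conv_rhs => rw [← v.2]
      exact Finset.single_le_sum (f := fun i : Fin k => (v.1 i).1 * ((i : ℕ) + 1))
        (fun _ _ => Nat.zero_le _) (Finset.mem_univ i)
    nlinarith [Nat.zero_le (i : ℕ)]
  refine Finite.of_injective
    (fun (v : I k) (i : Fin k) =>
      (⟨⟨(v.1 i).1, hb v i⟩, (v.1 i).2⟩ : Σ n : Fin (k + 1), (n : ℕ).Partition)) ?_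
  intro v w h
  refine Subtype.ext (funext fun i => ?_)
  have := congrFun h i
  exact congrArg (fun x : Σ n : Fin (k + 1), (n : ℕ).Partition => (⟨x.1, x.2⟩ : Ptn)) this

instance {k : ℕ} : Fintype (I k) := Fintype.ofFinite _

/-- The parts of `(1^{a₁} ⋯ k^{aₖ})` in nonincreasing order. -/
def ExpPtn.rows {k : ℕ} (a : ExpPtn k) : List ℕ :=
  (∑ i : Fin k, Multiset.replicate (a.1 i) ((i : ℕ) + 1)).sort (· ≥ ·)

/-- Partitions of the same integer in the lexicographic order of these lists are in the reverse
lexicographic order: `λ < μ` if `λᵢ > μᵢ` at the first `i` where `λ` and `μ` differ. -/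
def rlKey (l : List ℕ) : List ℕᵒᵈ := l.map OrderDual.toDual

/-- First compare the types, then the partitions `λ⁽¹⁾, λ⁽²⁾, …` in turn. -/
def orderKey {k : ℕ} (v : I k) : List ℕᵒᵈ ×ₗ Lex (Fin k → List ℕᵒᵈ) :=
  toLex (rlKey (type v).rows, toLex fun i => rlKey (rows (v.1 i).2))

theorem orderKey_injective {k : ℕ} : Function.Injective (orderKey : I k → _) := by
  intro v w h
  have h2 : (fun i => rlKey (rows (v.1 i).2)) = fun i => rlKey (rows (w.1 i).2) :=
    by
    have h3 := congrArg (fun x => ofLex (ofLex x).2) h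
    exact h3
  refine Subtype.ext (funext fun i => ?_)
  have h3 : rows (v.1 i).2 = rows (w.1 i).2 :=
    List.map_injective_iff.2 OrderDual.toDual.injective (congrFun h2 i)
  have h4 : (v.1 i).2.parts = (w.1 i).2.parts := by
    have := congrArg (fun l : List ℕ => (l : Multiset ℕ)) h3
    simpa [rows] using this
  generalize v.1 i = x at h4
  generalize w.1 i = y at h4
  obtain ⟨n, p⟩ := x
  obtain ⟨m, q⟩ := y
  have h5 : n = m := by
    rw [← p.parts_sum, ← q.parts_sum]
    exact congrArg Multiset.sum h4
  subst h5
  exact congrArg _ (Nat.Partition.ext h4)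

/-- The total order on `I k`. -/
instance {k : ℕ} : LinearOrder (I k) := LinearOrder.lift' orderKey orderKey_injective

/-! ### Representative set partitions and representatives of the generalized conjugacy classes -/

/-- Cut `[k]` into `a₁` intervals of length `1`, then `a₂` intervals of length `2`, and so on:
`⟨i, j, t⟩` is the place `t` in the interval number `j` of length `i + 1`. -/
def place {k : ℕ} (a : ExpPtn k) : Fin k ≃ Σ i : Fin k, Fin (a.1 i) × Fin ((i : ℕ) + 1) :=
  (finCongr a.2.symm).trans
    (finSigmaFinEquiv.symm.trans (Equiv.sigmaCongrRight fun _ => finProdFinEquiv.symm))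

/-- The interval of an element of `[k]`. -/
def blockOf {k : ℕ} (a : ExpPtn k) (x : Fin k) : Σ i : Fin k, Fin (a.1 i) :=
  ⟨(place a x).1, (place a x).2.1⟩

/-- The representative set partition of type `a`. -/
def repPartition {k : ℕ} (a : ExpPtn k) : Setoid (Fin k) := Setoid.ker (blockOf a)

/-- The parts of `p`, in nonincreasing order, as a composition. -/
def rowComposition {n : ℕ} (p : n.Partition) : Composition n where
  blocks := rows p
  blocks_pos {i} hi := p.parts_pos ((Multiset.mem_sort _).1 hi)
  blocks_sum := by
    have h : (rows p : Multiset ℕ).sum = n := by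
      rw [rows, Multiset.sort_eq]
      exact p.parts_sum
    simpa using h

/-- The permutation `(0 1 ⋯ p₁-1)(p₁ ⋯ p₁+p₂-1) ⋯` in cycle notation. -/
def repPerm {n : ℕ} (p : n.Partition) : Equiv.Perm (Fin n) :=
  (rowComposition p).blocksFinEquiv.permCongr
    (Equiv.sigmaCongrRight fun i => finRotate ((rowComposition p).blocksFun i))

theorem ncard_blockOf {k : ℕ} (a : ExpPtn k) (q : Σ i : Fin k, Fin (a.1 i)) :
    {x | blockOf a x = q}.ncard = (q.1 : ℕ) + 1 := by
  have e : {x | blockOf a x = q} =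
      Set.range (fun t : Fin ((q.1 : ℕ) + 1) => (place a).symm ⟨q.1, q.2, t⟩) := by
    ext x
    constructor
    · rintro rfl
      exact ⟨(place a x).2.2, (place a).symm_apply_apply x⟩
    · rintro ⟨t, rfl⟩
      change blockOf a _ = q
      unfold blockOf
      rw [Equiv.apply_symm_apply]
  rw [e, ← Nat.card_coe_set_eq, Nat.card_range_of_injective, Nat.card_fin]
  intro s t h
  simpa using h

/-- The permutation of the blocks of the representative set partition: on the blocks of size `i + 1`,
it is the representative permutation of cycle type `μ⁽ⁱ⁺¹⁾`. -/
def repBlockPerm {k : ℕ} (v : I k) : Equiv.Perm (Σ i : Fin k, Fin ((type v).1 i)) :=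
  Equiv.sigmaCongrRight fun i => repPerm (v.1 i).2

/-- The representative `d_μ`: the top block `B` is joined to the bottom block `τ(B)`, where `τ` is the
permutation `repBlockPerm μ` of the blocks of the representative set partition. -/
def rep {k : ℕ} (v : I k) : U k where
  rel := Setoid.ker (Sum.elim (fun x => repBlockPerm v (blockOf (type v) x)) (blockOf (type v)))
  uniform x := by
    have key : ∀ q, {a | q = repBlockPerm v (blockOf (type v) a)}.ncard =
        {b | q = blockOf (type v) b}.ncard := by
      intro q
      have e1 : {a | q = repBlockPerm v (blockOf (type v) a)} =
          {a | blockOf (type v) a = (repBlockPerm v).symm q} := by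
        ext a
        simp only [Set.mem_ofPred_eq, Equiv.eq_symm_apply]
        exact eq_comm
      have e2 : {b | q = blockOf (type v) b} = {b | blockOf (type v) b = q} := by
        ext a
        exact eq_comm
      rw [e1, e2, ncard_blockOf, ncard_blockOf]
      rfl
    exact key _

theorem rep_top {k : ℕ} (v : I k) : (rep v).top = repPartition (type v) := by
  ext x y
  exact (repBlockPerm v).injective.eq_iff

theorem rep_bot {k : ℕ} (v : I k) : (rep v).bot = repPartition (type v) := rfl

/-! ### Character tables -/

/-- The irreducible representation `V^λ` of the maximal subgroup at `e_π` (for `π` of the type of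
`λ`): the tensor product of the Specht modules of the groups of permutations of the blocks of size
`1, …, k`. -/
abbrev V {k : ℕ} (π : Setoid (Fin k)) (v : I k) : Type :=
  PiTensorProduct ℂ fun i : Fin k => Specht (v.1 i).2 (Block π i)

/-- The action of the maximal subgroup on `V^λ`. -/
def groupRep {k : ℕ} (π : Setoid (Fin k)) (v : I k) : Representation ℂ (G π) (V π v) :=
  PiTensorProduct.mapMonoidHom.comp
    (MonoidHom.pi fun i => (spechtRep (v.1 i).2 (Block π i)).comp (blockPerm π i))

/-- The irreducible representation `W^λ` of `U k`. -/
def irrep {k : ℕ} (v : I k) : Representation ℂ (U k) (Ind (groupRep (repPartition (type v)) v)) :=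
  indRep (groupRep (repPartition (type v)) v)

/-- The character table of `U k`. -/
def X (k : ℕ) : Matrix (I k) (I k) ℂ := fun l m => (irrep l).character (rep m)

/-- The block diagonal matrix whose blocks are the character tables of the representative maximal
subgroups. -/
def A (k : ℕ) : Matrix (I k) (I k) ℂ := fun l m =>
  if h : type m = type l then
    (groupRep (repPartition (type l)) l).character
      ⟨rep m, (rep_top m).trans (congrArg repPartition h), (rep_bot m).trans (congrArg repPartition h)⟩
  else 0

/-! ### Symmetric functions in several alphabets -/

/-- The ring `ℂ[p_i[X_j] : i, j ≥ 1]`; the variable `(i, j)` stands for `p_i[X_j]`. -/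
abbrev Sym : Type := MvPolynomial (ℕ+ × ℕ+) ℂ

/-- `z_p`, the product over `i` of `i ^ a * a!`, where `a` is the multiplicity of the part `i`. -/
def zPtn (p : Ptn) : ℕ :=
  ∏ i ∈ p.2.parts.toFinset, i ^ p.2.parts.count i * (p.2.parts.count i).factorial

def z {k : ℕ} (v : I k) : ℕ := ∏ i, zPtn (v.1 i)

/-- `p_μ[X]`, the product over the parts `r` of `μ⁽ʲ⁾` of the power sums `p_r[X_j]`. -/
def pX {k : ℕ} (v : I k) : Sym :=
  ∏ j : Fin k, ((v.1 j).2.parts.map fun r => (MvPolynomial.X (r.toPNat', (j : ℕ).succPNat) : Sym)).prod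

/-- `E_r`, the sum over `μ ∈ I r` of `p_μ[X] / z_μ`. -/
def E (r : ℕ) : Sym := ∑ v : I r, MvPolynomial.C ((z v : ℂ)⁻¹) * pX v

/-- Plethysm `p_m[f]`: every `p_r[X_j]` in `f` is replaced by `p_{m r}[X_j]`. -/
def plethysm (m : ℕ+) (f : Sym) : Sym := MvPolynomial.rename (fun x => (m * x.1, x.2)) f

/-- `p_ν[E]`, the product over the parts `r` of `ν⁽ʲ⁾` of `p_r[E_j]`. -/
def pE {k : ℕ} (v : I k) : Sym :=
  ∏ j : Fin k, ((v.1 j).2.parts.map fun r => plethysm r.toPNat' (E ((j : ℕ) + 1))).prod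

/-- The bilinear form for which the monomials `p_μ[X]` are orthogonal, with `⟨p_μ, p_μ⟩ = z_μ`: the
exponent of `p_i[X_j]` in `p_μ[X]` is the multiplicity of the part `i` in `μ⁽ʲ⁾`. -/
def scalar (f g : Sym) : ℂ :=
  ∑ e ∈ f.support, f.coeff e * g.coeff e * (e.prod fun x a => (x.1 : ℕ) ^ a * a.factorial : ℕ)

/-- The matrix with the entry `b_μ^ν = ⟨p_ν[E] / z_ν, p_μ[X]⟩` in the row `ν` and the column `μ`. -/
def B (k : ℕ) : Matrix (I k) (I k) ℂ := fun n m =>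
  scalar (MvPolynomial.C ((z n : ℂ)⁻¹) * pE n) (pX m)

/-! ### The combinatorial meaning of the entries of `B` -/

/-- The cycle type of an element of a maximal subgroup: for each `i`, the cycle type of the
permutation of the blocks of size `i + 1`. -/
def cycleType {k : ℕ} {π : Setoid (Fin k)} (g : G π) (i : Fin k) : Ptn :=
  ⟨_, (blockPerm π i g).partition⟩

/-- The diagrams `d` that are coarser than or equal to `c` and satisfy `top d = bot d` and
`cycletype d = ν`. (The type of `top d` is then the type of `ν`.) -/
def mergings {k : ℕ} (c : U k) (n : I k) : Set (U k) :=
  {d | c.rel ≤ d.rel ∧ ∃ h : d.bot = d.top, cycleType (⟨d, rfl, h⟩ : G d.top) = n.1}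

end

end UBP

namespace UBP

noncomputable section

open scoped Classical

/-! ### Cycle types of permutations -/

/-! Everything rests on the mergings of `d_μ`: the diagrams `d ≥ d_μ` with `top d = bot d` and cycle
type `ν`. Both the character table and the matrix `B` are expressed through their number.

Characters. The space `ℂ L ⊗ V` is a sum of copies of `V`, one for each set partition `σ` that is
the top of some `ℓ_σ` in `L`, because elements of `L` with equal tops differ by an element of the
maximal subgroup. Only those `σ` with `d_μ ℓ_σ = ℓ_σ g` contribute to the trace of `d_μ`, and the
contribution is `χ_V(g)` (`character_indRep`). For such `σ` the diagram `d_μ e_σ = ℓ_σ g ℓ_σ⁻¹` is a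
merging of `d_μ` with top `σ` and the cycle type of `g` (`mem_mergings_of_ratio`). Conversely a
merging `d` equals `d_μ e_{top d}` (`mul_idem_top_eq`), so it is determined by its top. Grouping by
cycle type gives `X_apply`.

Symmetric functions. Multiplication by `p_i[X_j]` is adjoint to `i ∂/∂p_i[X_j]`. By the Leibniz rule
the pairing of `p_ν[E]` with `p_μ[X]` is a sum over the maps `f` from the cycles of `μ` to the
cycles of `ν` (`pairing_prod`), and each factor `p_r[E_j]` is evaluated by `pairing_plethysm_E`. The
result is that `z_ν b` is the sum of `∏ len (f c)` over the `f` compatible with lengths and sizes.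
This is the number of maps of blocks that commute with the two permutations and add up sizes: the
first block of a cycle `c` may go to any of the `len (f c)` blocks of its image cycle
(`card_equivariant`). The automorphisms of the target, `z_ν` in number, act freely on these
surjective maps, and the orbits are the mergings (`card_blockMap_eq_mul`). Hence
`B_eq_ncard_mergings`.

Triangularity. Merging blocks moves the type down in the order (`rlKey_sort_le`). If the type stays
the same, nothing is merged and `ν = μ`. -/

theorem cycleType_eq_of_semiconj {α β : Type*} [Fintype α] [Fintype β] [DecidableEq α]
    [DecidableEq β] {σ : Equiv.Perm α} {τ : Equiv.Perm β} (e : α ≃ β)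
    (h : ∀ a, e (σ a) = τ (e a)) : σ.cycleType = τ.cycleType := by
  -- The permutations live on different types; `τ` is the extension of `σ` along `e`, seen as an
  -- equivalence onto the full subtype.
  let f : α ≃ Subtype (fun _ : β => True) := e.trans (Equiv.subtypeUnivEquiv fun _ => trivial).symm
  rw [← Equiv.Perm.cycleType_extendDomain f]
  congr 1
  ext b
  obtain ⟨a, rfl⟩ := e.surjective b
  rw [← h]
  rw [Equiv.Perm.extendDomain_apply_subtype σ f trivial]
  exact congrArg Subtype.val (congrArg f (congrArg σ (f.symm_apply_apply a)))

theorem partition_parts_eq_of_semiconj {α β : Type*} [Fintype α] [Fintype β] [DecidableEq α]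
    [DecidableEq β] {σ : Equiv.Perm α} {τ : Equiv.Perm β} (e : α ≃ β)
    (h : ∀ a, e (σ a) = τ (e a)) : σ.partition.parts = τ.partition.parts := by
  rw [Equiv.Perm.parts_partition, Equiv.Perm.parts_partition, ← Equiv.Perm.sum_cycleType,
    ← Equiv.Perm.sum_cycleType, cycleType_eq_of_semiconj e h, Fintype.card_congr e]

theorem exists_semiconj_of_partition_parts_eq {α β : Type*} [Fintype α] [Fintype β] [DecidableEq α]
    [DecidableEq β] {σ : Equiv.Perm α} {τ : Equiv.Perm β}
    (h : σ.partition.parts = τ.partition.parts) : ∃ e : α ≃ β, ∀ a, e (σ a) = τ (e a) := by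
  have hc : Fintype.card α = Fintype.card β := by
    rw [← σ.partition.parts_sum, h, τ.partition.parts_sum]
  let e := Fintype.equivOfCardEq hc
  have h1 : (e.permCongr σ).partition.parts = τ.partition.parts := by
    rw [← h]
    exact (partition_parts_eq_of_semiconj e fun a => by simp).symm
  obtain ⟨c, hc⟩ := isConj_iff.1 (Equiv.Perm.partition_eq_of_isConj.2 (Nat.Partition.ext h1))
  refine ⟨e.trans c, fun a => ?_⟩
  rw [← hc]
  simp

/-- The permutation is a product of pairwise disjoint ones, each moving a single summand, and cycle
types add over disjoint products. -/
theorem cycleType_sigmaCongrRight {ι : Type*} [Fintype ι] [DecidableEq ι] {β : ι → Type*}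
    [∀ i, Fintype (β i)] [∀ i, DecidableEq (β i)] (σ : ∀ i, Equiv.Perm (β i)) :
    (Equiv.Perm.sigmaCongrRight σ).cycleType = ∑ i, (σ i).cycleType := by
  have hcomm : ((Finset.univ : Finset ι) : Set ι).Pairwise fun i j =>
      Equiv.Perm.Disjoint (Equiv.Perm.sigmaCongrRight (Pi.mulSingle i (σ i)))
        (Equiv.Perm.sigmaCongrRight (Pi.mulSingle j (σ j))) := by
    rintro i - j - hij ⟨l, x⟩
    by_cases h : l = i
    · right
      have : l ≠ j := fun h2 => hij (h.symm.trans h2)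
      simp [Pi.mulSingle_eq_of_ne this]
    · left
      simp [Pi.mulSingle_eq_of_ne h]
  have h1 : Equiv.Perm.sigmaCongrRight σ =
      (Finset.univ : Finset ι).noncommProd
        (fun i => Equiv.Perm.sigmaCongrRight (Pi.mulSingle i (σ i)))
        (fun i hi j hj hij => (hcomm hi hj hij).commute) := by
    have h2 := Finset.map_noncommProd (Finset.univ : Finset ι) (fun i => Pi.mulSingle i (σ i))
      (fun i _ j _ _ => Pi.mulSingle_apply_commute σ i j) (Equiv.Perm.sigmaCongrRightHom β)
    rw [Finset.noncommProd_mulSingle] at h2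
    exact h2
  rw [h1, Equiv.Perm.Disjoint.cycleType_noncommProd hcomm]
  refine Finset.sum_congr rfl fun i _ => ?_
  let f : β i ≃ Subtype (fun x : Σ i, β i => x.1 = i) :=
    { toFun := fun x => ⟨⟨i, x⟩, rfl⟩
      invFun := fun x => cast (congrArg β x.2) x.1.2
      left_inv := fun x => rfl
      right_inv := by rintro ⟨⟨j, x⟩, rfl⟩; rfl }
  rw [← Equiv.Perm.cycleType_extendDomain f]
  congr 1
  refine Equiv.ext fun x => ?_
  obtain ⟨j, x⟩ := x
  by_cases h : j = i
  · subst h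
    have h3 := Equiv.Perm.extendDomain_apply_image (σ j) f x
    refine Eq.trans ?_ h3.symm
    simp [f]
  · refine Eq.trans ?_
      (Equiv.Perm.extendDomain_apply_not_subtype (σ i) f (b := ⟨j, x⟩) h).symm
    simp [Pi.mulSingle_eq_of_ne h]

theorem partition_parts_sigmaCongrRight {ι : Type*} [Fintype ι] [DecidableEq ι] {β : ι → Type*}
    [∀ i, Fintype (β i)] [∀ i, DecidableEq (β i)] (σ : ∀ i, Equiv.Perm (β i)) :
    (Equiv.Perm.sigmaCongrRight σ).partition.parts = ∑ i, (σ i).partition.parts := by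
  simp only [Equiv.Perm.parts_partition, Finset.sum_add_distrib]
  rw [← Equiv.Perm.sum_cycleType, cycleType_sigmaCongrRight, Fintype.card_sigma]
  congr 1
  -- Fixed points are the parts equal to 1. Their numbers add because no truncation occurs: each
  -- support is at most the whole summand.
  have h : (∑ i, Fintype.card (β i)) - (∑ i, (σ i).cycleType).sum =
      ∑ i, (Fintype.card (β i) - (σ i).support.card) := by
    rw [Finset.sum_tsub_distrib _ (fun i _ => Finset.card_le_univ _)]
    simp only [← Equiv.Perm.sum_cycleType]
    congr 1
    exact map_sum Multiset.sumAddMonoidHom _ _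
  rw [h]
  exact map_sum (Multiset.replicateAddMonoidHom 1) _ _

theorem partition_parts_finRotate {n : ℕ} (hn : 0 < n) : (finRotate n).partition.parts = {n} := by
  rw [Equiv.Perm.parts_partition, ← Equiv.Perm.sum_cycleType]
  -- Length 1 is separate: that rotation is the identity, with empty cycle type, and its part comes
  -- from the fixed point.
  obtain rfl | h := (Nat.succ_le_of_lt hn).eq_or_lt
  · rw [Subsingleton.elim (finRotate (Nat.succ 0)) 1, Equiv.Perm.cycleType_one]
    simp
  · rw [cycleType_finRotate_of_le h]
    simp

theorem partition_parts_repPerm {n : ℕ} (p : n.Partition) :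
    (repPerm p).partition.parts = p.parts := by
  have h1 : (Equiv.Perm.sigmaCongrRight fun i =>
      finRotate ((rowComposition p).blocksFun i)).partition.parts =
      (repPerm p).partition.parts :=
    partition_parts_eq_of_semiconj (rowComposition p).blocksFinEquiv fun a => by
      unfold repPerm
      rw [Equiv.permCongr_apply, Equiv.symm_apply_apply]
  rw [← h1, partition_parts_sigmaCongrRight]
  have h2 : ∀ i, (finRotate ((rowComposition p).blocksFun i)).partition.parts =
      {(rowComposition p).blocksFun i} :=
    fun i => partition_parts_finRotate ((rowComposition p).one_le_blocksFun i)
  simp only [h2]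
  have h3 : (rows p : Multiset ℕ) = p.parts := Multiset.sort_eq _ _
  rw [← h3, ← Multiset.sum_map_singleton (rows p : Multiset ℕ)]
  rw [Multiset.map_coe, Multiset.sum_coe]
  exact (Fin.sum_univ_fun_getElem (rows p) fun x => ({x} : Multiset ℕ))

theorem ptn_ext {p q : Ptn} (h : p.2.parts = q.2.parts) : p = q := by
  obtain ⟨n, p⟩ := p
  obtain ⟨m, q⟩ := q
  obtain rfl : n = m := by
    rw [← p.parts_sum, ← q.parts_sum]
    exact congrArg Multiset.sum h
  exact congrArg _ (Nat.Partition.ext h)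

/-! ### Diagrams given by labellings of the rows -/

section Labels

variable {k : ℕ} {Z : Type*}

/-- For a diagram given by labels on its two rows, a union of blocks is the same as a set of labels.
This makes products of labelled diagrams computable. -/
theorem sat_ker_iff (f g : Fin k → Z) (S T : Set (Fin k)) :
    Sat (Setoid.ker (Sum.elim f g)) S T ↔ ∃ P : Set Z, S = f ⁻¹' P ∧ T = g ⁻¹' P := by
  constructor
  · intro hs
    refine ⟨{z | ∃ x, Sum.elim S T x ∧ Sum.elim f g x = z}, ?_, ?_⟩
    · ext a
      exact ⟨fun ha => ⟨Sum.inl a, ha, rfl⟩, fun ⟨x, hx, hxa⟩ => (hs x (Sum.inl a) hxa).1 hx⟩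
    · ext a
      exact ⟨fun ha => ⟨Sum.inr a, ha, rfl⟩, fun ⟨x, hx, hxa⟩ => (hs x (Sum.inr a) hxa).1 hx⟩
  · rintro ⟨P, rfl, rfl⟩ x y hxy
    have e : ∀ x, Sum.elim (f ⁻¹' P) (g ⁻¹' P) x ↔ Sum.elim f g x ∈ P := by
      rintro (x | x) <;> rfl
    rw [e, e, show Sum.elim f g x = Sum.elim f g y from hxy]

theorem sat_iff_of_rel_eq_ker {d : U k} {f g : Fin k → Z} (h : d.rel = Setoid.ker (Sum.elim f g))
    (S T : Set (Fin k)) : Sat d.rel S T ↔ ∃ P : Set Z, S = f ⁻¹' P ∧ T = g ⁻¹' P :=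
  h ▸ sat_ker_iff f g S T

/-- If the middle row carries the same labels in both factors, the labels simply pass through.
Surjectivity of `g` lets the label set be recovered from its trace in the middle row. -/
theorem rel_mul_eq_ker {d e : U k} {f g h : Fin k → Z} (hg : Function.Surjective g)
    (hd : d.rel = Setoid.ker (Sum.elim f g)) (he : e.rel = Setoid.ker (Sum.elim g h)) :
    (d * e).rel = Setoid.ker (Sum.elim f h) := by
  refine rel_ext fun S T => ?_
  rw [sat_mul]
  rw [sat_ker_iff]
  constructor
  · rintro ⟨M, h1, h2⟩
    obtain ⟨P, rfl, hM⟩ := (sat_iff_of_rel_eq_ker hd _ _).1 h1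
    obtain ⟨Q, hM2, rfl⟩ := (sat_iff_of_rel_eq_ker he _ _).1 h2
    exact ⟨P, rfl, by rw [hg.preimage_injective (hM.symm.trans hM2)]⟩
  · rintro ⟨P, rfl, rfl⟩
    exact ⟨g ⁻¹' P, (sat_iff_of_rel_eq_ker hd _ _).2 ⟨P, rfl, rfl⟩,
      (sat_iff_of_rel_eq_ker he _ _).2 ⟨P, rfl, rfl⟩⟩

theorem rel_flip_eq_ker {d : U k} {f g : Fin k → Z} (hd : d.rel = Setoid.ker (Sum.elim f g)) :
    (flip d).rel = Setoid.ker (Sum.elim g f) := by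
  ext x y
  change d.rel x.swap y.swap ↔ _
  rw [hd]
  have e : ∀ x : Fin k ⊕ Fin k, Sum.elim f g x.swap = Sum.elim g f x := by
    rintro (x | x) <;> rfl
  rw [Setoid.ker_def, e, e]
  rfl

theorem ker_elim_comp {Z' : Type*} {f g : Fin k → Z} {ρ : Z → Z'} (hρ : Function.Injective ρ) :
    Setoid.ker (Sum.elim (ρ ∘ f) (ρ ∘ g)) = Setoid.ker (Sum.elim f g) := by
  ext x y
  rw [← Sum.comp_elim]
  exact hρ.eq_iff

theorem ncard_fiber_eq {d : U k} {f g : Fin k → Z} (h : d.rel = Setoid.ker (Sum.elim f g)) (z : Z) :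
    {x | f x = z}.ncard = {x | g x = z}.ncard :=
  Sat.ncard_eq d ((sat_iff_of_rel_eq_ker h _ _).2 ⟨{z}, rfl, rfl⟩)

/-- Every block meets the bottom row, so labels of the bottom blocks propagate to the top row. -/
theorem exists_rel_eq_ker (d : U k) {g : Fin k → Z} (hg : d.bot = Setoid.ker g) :
    ∃ f : Fin k → Z, d.rel = Setoid.ker (Sum.elim f g) := by
  choose b hb using exists_bot d
  have hg2 : ∀ x y, d.rel (Sum.inr x) (Sum.inr y) ↔ g x = g y := fun x y => by
    change d.bot x y ↔ _
    rw [hg]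
    rfl
  refine ⟨g ∘ b, ?_⟩
  let c : Fin k ⊕ Fin k → Fin k := Sum.elim b id
  have hc : ∀ x, d.rel x (Sum.inr (c x)) := by
    rintro (x | x)
    · exact hb x
    · exact d.rel.refl' _
  have hgc : ∀ x, Sum.elim (g ∘ b) g x = g (c x) := by
    rintro (x | x) <;> rfl
  ext x y
  rw [Setoid.ker_def, hgc, hgc, ← hg2]
  exact ⟨fun h => d.rel.trans' (d.rel.symm' (hc x)) (d.rel.trans' h (hc y)),
    fun h => d.rel.trans' (hc x) (d.rel.trans' h (d.rel.symm' (hc y)))⟩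

/-- The diagram whose blocks are the pairs of fibres of the labellings `f` and `g`. -/
def ofLabels (f g : Fin k → Z) (h : ∀ z, {x | f x = z}.ncard = {x | g x = z}.ncard) : U k where
  rel := Setoid.ker (Sum.elim f g)
  uniform x := by
    convert h (Sum.elim f g x) using 2
    · ext a
      exact eq_comm
    · ext a
      exact eq_comm

end Labels

/-! ### Labellings of the blocks and cycle types -/

section CycleType

variable {k : ℕ} {β : Fin k → Type} {π : Setoid (Fin k)}

/-- A labelling of the blocks of size `i + 1` by `β i`. -/
def IsLabelling (f : Fin k → Σ i, β i) : Prop := ∀ z, {x | f x = z}.ncard = (z.1 : ℕ) + 1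

theorem IsLabelling.surjective {f : Fin k → Σ i, β i} (h : IsLabelling f) :
    Function.Surjective f := fun z =>
  Set.nonempty_of_ncard_ne_zero (s := {x | f x = z}) (by rw [h z]; exact Nat.succ_ne_zero _)

theorem isLabelling_blockOf (a : ExpPtn k) : IsLabelling (blockOf a) := ncard_blockOf a

/-- The labels of size `i + 1` correspond to the blocks of size `i + 1`. -/
def labelEquiv {f : Fin k → Σ i, β i} (h : IsLabelling f) (i : Fin k) :
    β i ≃ Block (Setoid.ker f) i :=
  Equiv.ofBijective
    (fun x => ⟨{a | f a = ⟨i, x⟩}, by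
      obtain ⟨a, ha⟩ := h.surjective ⟨i, x⟩
      exact ⟨⟨a, by rw [← ha]; rfl⟩, h _⟩⟩) (by
    constructor
    · intro x y hxy
      have h1 : {a | f a = ⟨i, x⟩} = {a | f a = ⟨i, y⟩} := congrArg Subtype.val hxy
      obtain ⟨a, ha⟩ := h.surjective ⟨i, x⟩
      have h2 : f a = ⟨i, y⟩ := h1.subset ha
      exact eq_of_heq (Sigma.mk.inj (ha.symm.trans h2)).2
    · rintro ⟨B, ⟨a, rfl⟩, hB⟩
      have h1 : {x | f x = f a}.ncard = (i : ℕ) + 1 := hB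
      rw [h] at h1
      have h2 : (f a).1 = i := Fin.ext (Nat.succ_injective h1)
      subst h2
      exact ⟨(f a).2, rfl⟩)

variable [∀ i, Fintype (β i)] [∀ i, DecidableEq (β i)]

theorem parts_cycleType {f : Fin k → Σ i, β i} (h : IsLabelling f) {r : ∀ i, Equiv.Perm (β i)}
    (g : G π) (hg : g.1.rel = Setoid.ker (Sum.elim (Equiv.Perm.sigmaCongrRight r ∘ f) f))
    (i : Fin k) : (cycleType g i).2.parts = (r i).partition.parts := by
  have hπ : π = Setoid.ker f := by
    rw [← g.2.2, U.bot, hg]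
    rfl
  subst hπ
  -- The group acts from bottom blocks to top blocks, whereas `r` turns the label of a top block
  -- into that of the bottom block joined to it. Hence the inverse, which has the same cycle type.
  have h1 : (r i)⁻¹.partition.parts = (r i).partition.parts := by
    rw [Equiv.Perm.parts_partition, Equiv.Perm.parts_partition, Equiv.Perm.cycleType_inv,
      Equiv.Perm.support_inv]
  rw [← h1]
  refine (partition_parts_eq_of_semiconj (labelEquiv h i) fun x => ?_).symm
  refine Subtype.ext ?_
  change {a | f a = ⟨i, (r i)⁻¹ x⟩} = topMap g.1 {a | f a = ⟨i, x⟩}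
  have h2 : Sat g.1.rel {a | f a = ⟨i, (r i)⁻¹ x⟩} {a | f a = ⟨i, x⟩} := by
    refine (sat_iff_of_rel_eq_ker hg _ _).2 ⟨{⟨i, x⟩}, ?_, rfl⟩
    ext a
    change f a = _ ↔ Equiv.Perm.sigmaCongrRight r (f a) = ⟨i, x⟩
    rw [← Equiv.eq_symm_apply]
    rfl
  exact ((sat_iff _ _ _).1 h2).1

/-- The block of an element. -/
def blockAt (π : Setoid (Fin k)) (a : Fin k) : Σ i, Block π i :=
  ⟨⟨{x | π x a}.ncard - 1, by
    have h1 : 0 < {x | π x a}.ncard := (Set.ncard_pos (Set.toFinite _)).2 ⟨a, π.refl' a⟩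
    have h2 : {x | π x a}.ncard ≤ k := by
      simpa using Set.ncard_le_card {x | π x a}
    omega⟩, ⟨{x | π x a}, ⟨a, rfl⟩, by
    have h1 : 0 < {x | π x a}.ncard := (Set.ncard_pos (Set.toFinite _)).2 ⟨a, π.refl' a⟩
    change _ = _ - 1 + 1
    omega⟩⟩

theorem blockAt_eq_iff {a : Fin k} {i : Fin k} {B : Block π i} :
    blockAt π a = ⟨i, B⟩ ↔ a ∈ B.1 := by
  constructor
  · intro h
    have h1 : ∀ x : Σ i, Block π i, blockAt π a = x → a ∈ x.2.1 := by
      rintro _ rfl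
      exact π.refl' a
    exact h1 _ h
  · intro h
    obtain ⟨B, ⟨b, rfl⟩, hB⟩ := B
    have h1 : {x | π x a} = {x | π x b} := by
      ext x
      exact ⟨fun hx => π.trans' hx h, fun hx => π.trans' hx (π.symm' h)⟩
    have h2 : (blockAt π a).1 = i := by
      refine Fin.ext ?_
      change {x | π x a}.ncard - 1 = i
      rw [h1, hB]
      rfl
    have h3 : ∀ (x y : Σ i, Block π i), x.1 = y.1 → x.2.1 = y.2.1 → x = y := by
      rintro ⟨i, x⟩ ⟨j, y⟩ hij hxy
      obtain rfl : i = j := hij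
      exact congrArg _ (Subtype.ext hxy)
    exact h3 _ _ h2 h1

/-- Permutations with the same parts are conjugate by a bijection of the underlying sets; such a
bijection from blocks to labels, for each size, is the required labelling. -/
theorem exists_labelling {r : ∀ i, Equiv.Perm (β i)} (g : G π)
    (h : ∀ i, (cycleType g i).2.parts = (r i).partition.parts) :
    ∃ f : Fin k → Σ i, β i, IsLabelling f ∧
      g.1.rel = Setoid.ker (Sum.elim (Equiv.Perm.sigmaCongrRight r ∘ f) f) := by
  have h1 : ∀ i, ∃ e : Block π i ≃ β i, ∀ B, e ((blockPerm π i g)⁻¹ B) = r i (e B) := by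
    intro i
    refine exists_semiconj_of_partition_parts_eq (Eq.trans ?_ (h i))
    rw [Equiv.Perm.parts_partition, Equiv.Perm.cycleType_inv, Equiv.Perm.support_inv,
      ← Equiv.Perm.parts_partition]
    rfl
  choose e he using h1
  let E := Equiv.sigmaCongrRight e
  have hf : ∀ a z, E (blockAt π a) = z ↔ a ∈ (E.symm z).2.1 := fun a z => by
    rw [← Equiv.eq_symm_apply]
    exact blockAt_eq_iff
  have hker : π = Setoid.ker (E ∘ blockAt π) := by
    ext a b
    rw [Setoid.ker_def, Function.comp_apply, Function.comp_apply, E.injective.eq_iff]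
    exact (blockAt_eq_iff (a := a) (i := (blockAt π b).1) (B := (blockAt π b).2)).symm
  refine ⟨E ∘ blockAt π, ?_, ?_⟩
  · intro z
    have h2 : {x | (E ∘ blockAt π) x = z} = (E.symm z).2.1 := by
      ext a
      exact hf a z
    rw [h2]
    exact (E.symm z).2.2.2
  · obtain ⟨f, hf2⟩ := exists_rel_eq_ker g.1 (g.2.2.trans hker)
    rw [hf2]
    congr 2
    funext a
    obtain ⟨b, hb⟩ := exists_bot g.1 a
    have h3 : f a = E (blockAt π b) := by
      rw [hf2] at hb
      exact hb
    rw [h3]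
    have h4 : b ∈ (blockAt π b).2.1 := π.refl' b
    have h5 : blockAt π a = ⟨(blockAt π b).1, g • (blockAt π b).2⟩ :=
      blockAt_eq_iff.2 ⟨b, h4, hb⟩
    change _ = Equiv.Perm.sigmaCongrRight r (E (blockAt π a))
    rw [h5]
    change (⟨_, e _ _⟩ : Σ i, β i) = ⟨_, r _ (e _ (g • (blockAt π b).2))⟩
    rw [← he]
    congr 2
    exact (inv_smul_smul g _).symm

/-- Normal form: up to relabelling the blocks, an element of cycle type `n` is the representative.
Cycle types are handled through such labellings from here on. -/
theorem cycleType_eq_iff {n : I k} (g : G π) :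
    cycleType g = n.1 ↔ ∃ f : Fin k → Σ i, Fin ((type n).1 i), IsLabelling f ∧
      g.1.rel = Setoid.ker (Sum.elim (repBlockPerm n ∘ f) f) := by
  constructor
  · intro h
    refine exists_labelling g fun i => ?_
    rw [h]
    exact (partition_parts_repPerm (n.1 i).2).symm
  · rintro ⟨f, hf, hg⟩
    funext i
    refine ptn_ext ?_
    exact (parts_cycleType hf g hg i).trans (partition_parts_repPerm (n.1 i).2)

theorem cycleType_rep (n : I k) (h : (rep n).top = π ∧ (rep n).bot = π) :
    cycleType (⟨rep n, h⟩ : G π) = n.1 :=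
  (cycleType_eq_iff _).2 ⟨blockOf (type n), isLabelling_blockOf _, rfl⟩

theorem mem_mergings_iff {c d : U k} {n : I k} :
    d ∈ mergings c n ↔ c.rel ≤ d.rel ∧ ∃ f : Fin k → Σ i, Fin ((type n).1 i), IsLabelling f ∧
      d.rel = Setoid.ker (Sum.elim (repBlockPerm n ∘ f) f) := by
  refine and_congr_right fun _ => ?_
  constructor
  · rintro ⟨h, hc⟩
    exact (cycleType_eq_iff _).1 hc
  · rintro ⟨f, hf, hd⟩
    have h : d.bot = d.top := by
      rw [U.bot, U.top, hd]
      ext x y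
      exact (repBlockPerm n).injective.eq_iff.symm
    exact ⟨h, (cycleType_eq_iff (⟨d, rfl, h⟩ : G d.top)).2 ⟨f, hf, hd⟩⟩

end CycleType

/-! ### The scalar product of symmetric functions -/

/-- The norm of the monomial with the given exponents. -/
def zeta (e : ℕ+ × ℕ+ →₀ ℕ) : ℕ := e.prod fun x a => (x.1 : ℕ) ^ a * a.factorial

/-- The scalar product of `P` with the monomial with exponents `e`. -/
def pairing (P : Sym) (e : ℕ+ × ℕ+ →₀ ℕ) : ℂ := P.coeff e * zeta e

theorem scalar_monomial (f : Sym) (e : ℕ+ × ℕ+ →₀ ℕ) :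
    scalar f (MvPolynomial.monomial e 1) = pairing f e := by
  unfold scalar pairing
  rw [Finset.sum_eq_single e]
  · rw [MvPolynomial.coeff_monomial, if_pos rfl, mul_one]
    rfl
  · intro b _ hb
    rw [MvPolynomial.coeff_monomial, if_neg (Ne.symm hb)]
    simp
  · intro h
    rw [MvPolynomial.notMem_support_iff.1 h]
    simp

theorem pairing_sum {ι : Type*} (s : Finset ι) (P : ι → Sym) (e) :
    pairing (∑ i ∈ s, P i) e = ∑ i ∈ s, pairing (P i) e := by
  simp [pairing, MvPolynomial.coeff_sum, Finset.sum_mul]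

theorem pairing_C_mul (c : ℂ) (P : Sym) (e) :
    pairing (MvPolynomial.C c * P) e = c * pairing P e := by
  simp [pairing, mul_assoc]

theorem zeta_pos (e : ℕ+ × ℕ+ →₀ ℕ) : 0 < zeta e :=
  Finset.prod_pos fun x _ => Nat.mul_pos (pow_pos x.1.pos _) (Nat.factorial_pos _)

theorem zeta_zero : zeta 0 = 1 := Finsupp.prod_zero_index

theorem zeta_add_single (e : ℕ+ × ℕ+ →₀ ℕ) (x : ℕ+ × ℕ+) :
    zeta (e + Finsupp.single x 1) = x.1 * (e x + 1) * zeta e := by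
  have h0 : ∀ i ∈ insert x e.support, (i.1 : ℕ) ^ 0 * Nat.factorial 0 = 1 := by simp
  have h1 : (e + Finsupp.single x 1).support ⊆ insert x e.support := by
    intro y hy
    by_contra h
    simp only [Finset.mem_insert, Finsupp.mem_support_iff, not_or, not_not] at h hy
    apply hy
    rw [Finsupp.add_apply, h.2, Finsupp.single_eq_of_ne (by tauto), add_zero]
  unfold zeta
  rw [Finsupp.prod_of_support_subset _ h1 (fun x a => (x.1 : ℕ) ^ a * a.factorial) h0,
    Finsupp.prod_of_support_subset _ (Finset.subset_insert x e.support)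
      (fun x a => (x.1 : ℕ) ^ a * a.factorial) h0,
    ← Finset.mul_prod_erase _ _ (Finset.mem_insert_self x e.support),
    ← Finset.mul_prod_erase _ _ (Finset.mem_insert_self x e.support), ← mul_assoc]
  congr 1
  · rw [Finsupp.add_apply, Finsupp.single_eq_same, pow_succ, Nat.factorial_succ]
    ring
  · refine Finset.prod_congr rfl fun y hy => ?_
    rw [Finsupp.add_apply, Finsupp.single_eq_of_ne (Finset.ne_of_mem_erase hy), add_zero]

/-- Up to the factor `i`, differentiation by `p_i[X_j]` is adjoint to multiplication by it. -/
theorem pairing_add_single (P : Sym) (e : ℕ+ × ℕ+ →₀ ℕ) (x : ℕ+ × ℕ+) :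
    pairing P (e + Finsupp.single x 1) = x.1 * pairing (MvPolynomial.pderiv x P) e := by
  unfold pairing
  rw [zeta_add_single, MvPolynomial.coeff_pderiv]
  push_cast
  ring

theorem pderiv_prod {D : Type*} [DecidableEq D] (s : Finset D) (P : D → Sym) (x : ℕ+ × ℕ+) :
    MvPolynomial.pderiv x (∏ q ∈ s, P q) =
      ∑ q ∈ s, MvPolynomial.pderiv x (P q) * ∏ q' ∈ s.erase q, P q' := by
  induction s using Finset.induction_on with
  | empty => simp
  | insert a s ha ih =>
    rw [Finset.prod_insert ha, Derivation.leibniz, ih, Finset.sum_insert ha,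
      Finset.erase_insert ha, add_comm, smul_eq_mul, smul_eq_mul, mul_comm (∏ q ∈ s, P q),
      Finset.mul_sum]
    congr 1
    refine Finset.sum_congr rfl fun q hq => ?_
    have hqa : a ≠ q := fun h => ha (h ▸ hq)
    rw [Finset.erase_insert_of_ne hqa, Finset.prod_insert (fun h => ha (Finset.mem_of_mem_erase h))]
    ring

/-- The variables of the monomial are stripped off one at a time as derivatives. By the Leibniz rule
each derivative hits exactly one factor, and `f` records which one. -/
theorem pairing_prod_fin {D : Type*} [Fintype D] [DecidableEq D] (N : ℕ)
    (x : Fin N → ℕ+ × ℕ+) (P : D → Sym) :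
    pairing (∏ q, P q) (∑ c, Finsupp.single (x c) 1) =
      ∑ f : Fin N → D, ∏ q, pairing (P q) (∑ c, if f c = q then Finsupp.single (x c) 1 else 0) := by
  induction N generalizing P with
  | zero =>
    -- Without variables the pairing is the constant coefficient, which is multiplicative.
    simp only [Finset.univ_eq_empty, Finset.sum_empty, Fintype.sum_unique]
    simp only [pairing, zeta_zero, Nat.cast_one, mul_one, ← MvPolynomial.constantCoeff_eq, map_prod]
  | succ N ih =>
    rw [Fin.sum_univ_succ, add_comm, pairing_add_single, pderiv_prod, pairing_sum,
      ← (Fin.consEquiv fun _ => D).sum_comp, Fintype.sum_prod_type, Finset.mul_sum]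
    refine Finset.sum_congr rfl fun q0 _ => ?_
    -- The differentiated product is again a product over the same index set, with one factor
    -- replaced; this is why the induction is over all `P`.
    have h1 : MvPolynomial.pderiv (x 0) (P q0) * ∏ q ∈ Finset.univ.erase q0, P q =
        ∏ q, Function.update P q0 (MvPolynomial.pderiv (x 0) (P q0)) q := by
      rw [← Finset.mul_prod_erase _ _ (Finset.mem_univ q0), Function.update_self]
      congr 1
      exact Finset.prod_congr rfl fun q hq => by
        rw [Function.update_of_ne (Finset.ne_of_mem_erase hq)]
    rw [h1, ih, Finset.mul_sum]
    refine Finset.sum_congr rfl fun f _ => ?_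
    rw [← Finset.mul_prod_erase _ _ (Finset.mem_univ q0),
      ← Finset.mul_prod_erase _ _ (Finset.mem_univ q0), ← mul_assoc]
    congr 1
    · rw [Function.update_self, ← pairing_add_single, Fin.sum_univ_succ, add_comm]
      simp [Fin.consEquiv]
    · refine Finset.prod_congr rfl fun q hq => ?_
      rw [Function.update_of_ne (Finset.ne_of_mem_erase hq), Fin.sum_univ_succ]
      simp [Fin.consEquiv, (Finset.ne_of_mem_erase hq).symm]

theorem pairing_prod {C D : Type*} [Fintype C] [Fintype D] [DecidableEq C] [DecidableEq D]
    (x : C → ℕ+ × ℕ+) (P : D → Sym) :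
    pairing (∏ q, P q) (∑ c, Finsupp.single (x c) 1) =
      ∑ f : C → D, ∏ q, pairing (P q) (∑ c, if f c = q then Finsupp.single (x c) 1 else 0) := by
  let e := Fintype.equivFin C
  rw [← e.symm.sum_comp, pairing_prod_fin, ← (e.arrowCongr (Equiv.refl D)).sum_comp]
  refine Finset.sum_congr rfl fun f _ => Finset.prod_congr rfl fun q _ => ?_
  congr 1
  rw [← e.symm.sum_comp]
  rfl

/-! ### The multiset of the cycles of a tuple of partitions -/

/-- The pairs of the length of a cycle and the size of the blocks which it permutes. -/
def cycles {k : ℕ} (v : I k) : Multiset (ℕ+ × ℕ+) :=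
  ∑ i : Fin k, (v.1 i).2.parts.map fun r => (r.toPNat', (i : ℕ).succPNat)

/-- The sum of the products of the components. -/
def weight (s : Multiset (ℕ+ × ℕ+)) : ℕ := (s.map fun x => (x.1 : ℕ) * x.2).sum

theorem monomial_toFinsupp (s : Multiset (ℕ+ × ℕ+)) :
    (MvPolynomial.monomial (Multiset.toFinsupp s) 1 : Sym) = (s.map MvPolynomial.X).prod := by
  induction s using Multiset.induction_on with
  | empty => simp
  | cons a s ih =>
    rw [Multiset.map_cons, Multiset.prod_cons, ← ih, ← Multiset.singleton_add,
      Multiset.toFinsupp_add, Multiset.toFinsupp_singleton, MvPolynomial.X,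
      MvPolynomial.monomial_mul, one_mul]

theorem pX_eq {k : ℕ} (v : I k) :
    pX v = MvPolynomial.monomial (Multiset.toFinsupp (cycles v)) 1 := by
  rw [monomial_toFinsupp, cycles, pX]
  have h1 := map_sum (Multiset.mapAddMonoidHom (MvPolynomial.X : ℕ+ × ℕ+ → Sym))
    (fun i : Fin k => (v.1 i).2.parts.map fun r => (r.toPNat', (i : ℕ).succPNat)) Finset.univ
  have h2 : ∀ f : Fin k → Multiset Sym, (∑ i, f i).prod = ∏ i, (f i).prod := fun f => by
    induction (Finset.univ : Finset (Fin k)) using Finset.induction_on with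
    | empty => simp
    | insert a s ha ih => rw [Finset.sum_insert ha, Finset.prod_insert ha, Multiset.prod_add, ih]
  rw [Multiset.coe_mapAddMonoidHom] at h1
  rw [h1, h2]
  simp only [Multiset.map_map]
  rfl

theorem injOn_toPNat' {n : ℕ} (p : n.Partition) (j : ℕ+) :
    Set.InjOn (fun r : ℕ => (r.toPNat', j)) {r | r ∈ p.parts} := by
  intro a ha b hb hab
  have h1 := congrArg (fun x : ℕ+ × ℕ+ => (x.1 : ℕ)) hab
  have h2 := p.parts_pos ha
  have h3 := p.parts_pos hb
  simpa [Nat.toPNat'_coe, h2, h3] using h1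

theorem count_cycles {k : ℕ} (v : I k) (r : ℕ) (hr : 0 < r) (i : Fin k) :
    (cycles v).count (r.toPNat', (i : ℕ).succPNat) = (v.1 i).2.parts.count r := by
  unfold cycles
  rw [Multiset.count_sum', Finset.sum_eq_single i]
  · by_cases h : r ∈ (v.1 i).2.parts
    · exact Multiset.count_map_eq_count _ _ (injOn_toPNat' _ _) _ h
    · rw [Multiset.count_eq_zero_of_notMem h, Multiset.count_eq_zero_of_notMem]
      intro h2
      obtain ⟨a, ha, hab⟩ := Multiset.mem_map.1 h2
      have h1 := congrArg (fun x : ℕ+ × ℕ+ => (x.1 : ℕ)) hab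
      have h3 := (v.1 i).2.parts_pos ha
      simp only [Nat.toPNat'_coe, h3, hr, if_true] at h1
      exact h (h1 ▸ ha)
  · intro j _ hj
    refine Multiset.count_eq_zero_of_notMem fun h2 => ?_
    obtain ⟨a, ha, hab⟩ := Multiset.mem_map.1 h2
    exact hj (Fin.ext (Nat.succPNat_injective (congrArg Prod.snd hab)))
  · simp

theorem cycles_injective {k : ℕ} : Function.Injective (cycles : I k → _) := by
  intro v w h
  refine Subtype.ext (funext fun i => ptn_ext ?_)
  ext r
  obtain rfl | hr := Nat.eq_zero_or_pos r
  · rw [Multiset.count_eq_zero_of_notMem fun h => lt_irrefl 0 ((v.1 i).2.parts_pos h),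
      Multiset.count_eq_zero_of_notMem fun h => lt_irrefl 0 ((w.1 i).2.parts_pos h)]
  · rw [← count_cycles v r hr, ← count_cycles w r hr, h]

theorem weight_add (s t : Multiset (ℕ+ × ℕ+)) : weight (s + t) = weight s + weight t := by
  simp [weight]

theorem weight_sum {ι : Type*} (s : Finset ι) (f : ι → Multiset (ℕ+ × ℕ+)) :
    weight (∑ i ∈ s, f i) = ∑ i ∈ s, weight (f i) :=
  map_sum (⟨⟨weight, rfl⟩, weight_add⟩ : Multiset (ℕ+ × ℕ+) →+ ℕ) _ _

theorem weight_map_parts {n : ℕ} (p : n.Partition) (i : ℕ) :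
    weight (p.parts.map fun r => (r.toPNat', i.succPNat)) = n * (i + 1) := by
  calc _ = p.parts.sum * (i + 1) := by
        conv_rhs => rw [← Multiset.map_id p.parts, ← Multiset.sum_map_mul_right]
        rw [weight, Multiset.map_map]
        refine congrArg Multiset.sum (Multiset.map_congr rfl fun r hr => ?_)
        simp [Nat.toPNat'_coe, p.parts_pos hr]
    _ = n * (i + 1) := by rw [p.parts_sum]

theorem weight_cycles {k : ℕ} (v : I k) : weight (cycles v) = k := by
  unfold cycles
  rw [weight_sum]
  exact (Finset.sum_congr rfl fun i _ => weight_map_parts _ _).trans v.2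

/-- With `cycles_injective` and `weight_cycles`, this identifies `I k` with the monomials of weight
`k`, so that each of them occurs exactly once in `E k`. -/
theorem exists_cycles_eq {k : ℕ} (s : Multiset (ℕ+ × ℕ+)) (hs : weight s = k) :
    ∃ v : I k, cycles v = s := by
  let p : Fin k → Multiset ℕ := fun i =>
    (s.filter fun x => x.2 = (i : ℕ).succPNat).map fun x => (x.1 : ℕ)
  have hp : ∀ i, ∀ {r : ℕ}, r ∈ p i → 0 < r := by
    intro i r hr
    obtain ⟨x, _, rfl⟩ := Multiset.mem_map.1 hr
    exact x.1.pos
  let w : Fin k → Ptn := fun i => ⟨(p i).sum, ⟨p i, hp i, rfl⟩⟩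
  have h1 : ∑ i : Fin k, ((w i).2.parts.map fun r => (r.toPNat', (i : ℕ).succPNat)) = s := by
    have h2 : ∀ i : Fin k, ((w i).2.parts.map fun r => (r.toPNat', (i : ℕ).succPNat)) =
        s.filter fun x => x.2 = (i : ℕ).succPNat := by
      intro i
      change ((s.filter _).map _).map _ = _
      rw [Multiset.map_map]
      conv_rhs => rw [← Multiset.map_id (s.filter _)]
      refine Multiset.map_congr rfl fun x hx => ?_
      have h3 := (Multiset.mem_filter.1 hx).2
      refine Prod.ext ?_ h3.symm
      exact PNat.coe_toPNat' x.1
    simp only [h2]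
    ext x
    rw [Multiset.count_sum']
    simp only [Multiset.count_filter]
    by_cases hx : x ∈ s
    · have h4 : (x.1 : ℕ) * x.2 ≤ k := by
        rw [← hs]
        exact Multiset.single_le_sum (fun _ _ => Nat.zero_le _) _
          (Multiset.mem_map_of_mem (fun x : ℕ+ × ℕ+ => (x.1 : ℕ) * x.2) hx)
      have h5 : (x.2 : ℕ) ≤ k := le_trans (Nat.le_mul_of_pos_left _ x.1.pos) h4
      have h6 := x.2.pos
      rw [Finset.sum_eq_single (⟨x.2 - 1, by omega⟩ : Fin k)]
      · rw [if_pos]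
        refine PNat.coe_injective ?_
        simp
        omega
      · intro j _ hj
        rw [if_neg]
        intro h7
        apply hj
        ext
        simp [h7]
      · simp
    · rw [Multiset.count_eq_zero_of_notMem hx]
      simp
  have h2 : ∑ i, (w i).1 * ((i : ℕ) + 1) = k := by
    refine Eq.trans ?_ hs
    rw [← h1, weight_sum]
    exact Finset.sum_congr rfl fun i _ => (weight_map_parts _ _).symm
  exact ⟨⟨w, h2⟩, h1⟩

theorem z_eq {k : ℕ} (v : I k) : z v = zeta (Multiset.toFinsupp (cycles v)) := by
  unfold z zPtn zeta Finsupp.prod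
  rw [Finset.prod_sigma']
  have hmem : ∀ x : (_ : Fin k) × ℕ, x ∈ Finset.univ.sigma (fun i => (v.1 i).2.parts.toFinset) →
      0 < x.2 := fun x hx =>
    (v.1 x.1).2.parts_pos (Multiset.mem_toFinset.1 (Finset.mem_sigma.1 hx).2)
  refine Finset.prod_bij (fun x _ => (x.2.toPNat', (x.1 : ℕ).succPNat)) ?_ ?_ ?_ ?_
  · intro x hx
    rw [Multiset.toFinsupp_support, Multiset.mem_toFinset, ← Multiset.count_pos,
      count_cycles v _ (hmem x hx), Multiset.count_pos]
    exact Multiset.mem_toFinset.1 (Finset.mem_sigma.1 hx).2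
  · rintro ⟨i, r⟩ hx ⟨j, r'⟩ hy h
    obtain rfl : i = j := Fin.ext (Nat.succPNat_injective (congrArg Prod.snd h))
    obtain rfl : r = r' := injOn_toPNat' (v.1 i).2 _
      (Multiset.mem_toFinset.1 (Finset.mem_sigma.1 hx).2)
      (Multiset.mem_toFinset.1 (Finset.mem_sigma.1 hy).2) h
    rfl
  · intro x hx
    rw [Multiset.toFinsupp_support, Multiset.mem_toFinset, cycles, Multiset.mem_sum] at hx
    obtain ⟨i, _, hx⟩ := hx
    obtain ⟨r, hr, rfl⟩ := Multiset.mem_map.1 hx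
    exact ⟨⟨i, r⟩, Finset.mem_sigma.2 ⟨Finset.mem_univ _, Multiset.mem_toFinset.2 hr⟩, rfl⟩
  · intro x hx
    rw [Multiset.toFinsupp_apply, count_cycles v _ (hmem x hx)]
    simp [Nat.toPNat'_coe, hmem x hx]

theorem coeff_E (j : ℕ) (s : Multiset (ℕ+ × ℕ+)) :
    (E j).coeff (Multiset.toFinsupp s) =
      if weight s = j then (zeta (Multiset.toFinsupp s) : ℂ)⁻¹ else 0 := by
  unfold E
  rw [MvPolynomial.coeff_sum]
  simp only [pX_eq, MvPolynomial.coeff_C_mul, MvPolynomial.coeff_monomial,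
    Multiset.toFinsupp.injective.eq_iff, mul_ite, mul_one, mul_zero]
  split_ifs with h
  · obtain ⟨v, rfl⟩ := exists_cycles_eq s h
    simp only [cycles_injective.eq_iff, Finset.sum_ite_eq', Finset.mem_univ, if_true, z_eq]
  · refine Finset.sum_eq_zero fun v _ => if_neg ?_
    rintro rfl
    exact h (weight_cycles v)

/-! ### Plethysm -/

/-- Multiply the length by `r`. -/
def scale (r : ℕ+) (x : ℕ+ × ℕ+) : ℕ+ × ℕ+ := (r * x.1, x.2)

theorem scale_injective (r : ℕ+) : Function.Injective (scale r) := by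
  rintro ⟨a, b⟩ ⟨c, d⟩ h
  have h1 := congrArg Prod.fst h
  have h2 := congrArg Prod.snd h
  exact Prod.ext (mul_left_cancel h1) h2

theorem toFinsupp_map_scale (r : ℕ+) (s : Multiset (ℕ+ × ℕ+)) :
    Multiset.toFinsupp (s.map (scale r)) = (Multiset.toFinsupp s).mapDomain (scale r) := by
  induction s using Multiset.induction_on with
  | empty => simp
  | cons a s ih =>
    rw [Multiset.map_cons, ← Multiset.singleton_add, ← Multiset.singleton_add,
      Multiset.toFinsupp_add, Multiset.toFinsupp_add, Finsupp.mapDomain_add, ih,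
      Multiset.toFinsupp_singleton, Multiset.toFinsupp_singleton, Finsupp.mapDomain_single]

theorem zeta_map_scale (r : ℕ+) (s : Multiset (ℕ+ × ℕ+)) :
    zeta (Multiset.toFinsupp (s.map (scale r))) =
      (r : ℕ) ^ s.card * zeta (Multiset.toFinsupp s) := by
  induction s using Multiset.induction_on with
  | empty => simp
  | cons a s ih =>
    rw [Multiset.map_cons, ← Multiset.singleton_add, ← Multiset.singleton_add,
      add_comm, add_comm _ s, Multiset.toFinsupp_add, Multiset.toFinsupp_add,
      Multiset.toFinsupp_singleton, Multiset.toFinsupp_singleton, zeta_add_single, zeta_add_single,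
      ih, Multiset.toFinsupp_apply, Multiset.toFinsupp_apply,
      Multiset.count_map_eq_count' _ _ (scale_injective r), Multiset.card_add,
      Multiset.card_singleton, pow_succ]
    simp only [scale, PNat.mul_coe]
    ring

theorem weight_map_scale (r : ℕ+) (s : Multiset (ℕ+ × ℕ+)) :
    weight (s.map (scale r)) = r * weight s := by
  unfold weight
  rw [Multiset.map_map, ← Multiset.sum_map_mul_left]
  refine congrArg Multiset.sum (Multiset.map_congr rfl fun x _ => ?_)
  simp [scale, mul_assoc]

/-- The monomials of `p_r[E_j]` are those of `E_j` with all lengths multiplied by `r`. Their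
coefficients are inverse norms before scaling, and scaling multiplies the norm by `r` for each
variable, so a power of `r` remains. -/
theorem pairing_plethysm_E (r : ℕ+) (j : ℕ) (s : Multiset (ℕ+ × ℕ+)) :
    pairing (plethysm r (E j)) (Multiset.toFinsupp s) =
      if (∀ x ∈ s, r ∣ x.1) ∧ weight s = r * j then (r : ℂ) ^ s.card else 0 := by
  by_cases h : ∀ x ∈ s, r ∣ x.1
  · obtain ⟨t, rfl⟩ : ∃ t : Multiset (ℕ+ × ℕ+), t.map (scale r) = s := by
      choose! c hc using h
      refine ⟨s.map fun x => (c x, x.2), ?_⟩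
      rw [Multiset.map_map]
      conv_rhs => rw [← Multiset.map_id s]
      exact Multiset.map_congr rfl fun x hx => Prod.ext (hc x hx).symm rfl
    have h1 : (plethysm r (E j)).coeff (Multiset.toFinsupp (t.map (scale r))) =
        (E j).coeff (Multiset.toFinsupp t) := by
      rw [toFinsupp_map_scale]
      exact MvPolynomial.coeff_rename_mapDomain _ (scale_injective r) _ _
    have h2 : weight (t.map (scale r)) = r * j ↔ weight t = j := by
      rw [weight_map_scale]
      exact Nat.mul_right_inj r.pos.ne'
    unfold pairing
    rw [h1, coeff_E, zeta_map_scale, Multiset.card_map]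
    rw [if_congr ((and_iff_right h).trans h2) rfl rfl]
    split_ifs with h3
    · have h4 : (zeta (Multiset.toFinsupp t) : ℂ) ≠ 0 := Nat.cast_ne_zero.2 (zeta_pos _).ne'
      push_cast
      field_simp
    · rw [zero_mul]
  · rw [if_neg (fun h2 => h h2.1), pairing, plethysm, MvPolynomial.coeff_rename_eq_zero, zero_mul]
    -- Every variable of a renamed monomial has length divisible by `r`, contrary to the failure of
    -- `h`.
    intro u hu
    exfalso
    apply h
    intro x hx
    have h1 : x ∈ (Finsupp.mapDomain (fun x : ℕ+ × ℕ+ => (r * x.1, x.2)) u).support := by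
      rw [hu]
      simpa using hx
    obtain ⟨y, _, rfl⟩ := Finset.mem_image.1 (Finsupp.mapDomain_support h1)
    exact dvd_mul_right _ _

/-! ### The entries of `B` as sums over maps of cycles -/

/-- The cycles of the representative permutation. -/
abbrev Cyc {k : ℕ} (v : I k) : Type := Σ i : Fin k, Fin (rows (v.1 i).2).length

/-- The length of a cycle. -/
def Cyc.len {k : ℕ} {v : I k} (c : Cyc v) : ℕ := (rows (v.1 c.1).2).get c.2

theorem Cyc.len_pos {k : ℕ} {v : I k} (c : Cyc v) : 0 < c.len :=
  (v.1 c.1).2.parts_pos ((Multiset.mem_sort _).1 (List.get_mem _ _))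

/-- The pair of the length and the block size of a cycle. -/
def Cyc.lenSize {k : ℕ} {v : I k} (c : Cyc v) : ℕ+ × ℕ+ := (c.len.toPNat', (c.1 : ℕ).succPNat)

theorem map_parts_eq {n : ℕ} (p : n.Partition) {α : Type*} (f : ℕ → α) :
    p.parts.map f = (Finset.univ : Finset (Fin (rows p).length)).val.map
      fun t => f ((rows p).get t) := by
  have h1 : (rows p : Multiset ℕ) = p.parts := Multiset.sort_eq _ _
  rw [← h1, Multiset.map_coe, Fin.univ_val_map]
  congr 1
  conv_lhs => rw [← List.ofFn_get (rows p)]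
  rw [List.map_ofFn]
  rfl

theorem toFinsupp_cycles {k : ℕ} (v : I k) :
    Multiset.toFinsupp (cycles v) = ∑ c : Cyc v, Finsupp.single c.lenSize 1 := by
  unfold cycles
  rw [map_sum, Fintype.sum_sigma]
  refine Finset.sum_congr rfl fun i _ => ?_
  rw [map_parts_eq]
  have h1 : ∀ f : Fin (rows (v.1 i).2).length → ℕ+ × ℕ+,
      Multiset.toFinsupp (Finset.univ.val.map f) = ∑ t, Finsupp.single (f t) 1 := fun f => by
    rw [← Multiset.sum_map_singleton (Finset.univ.val.map f), Multiset.map_map]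
    refine (map_sum Multiset.toFinsupp (fun t => ({f t} : Multiset (ℕ+ × ℕ+))) Finset.univ).trans ?_
    simp only [Multiset.toFinsupp_singleton]
  exact h1 _

theorem pE_eq {k : ℕ} (v : I k) :
    pE v = ∏ q : Cyc v, plethysm q.len.toPNat' (E ((q.1 : ℕ) + 1)) := by
  unfold pE
  rw [Fintype.prod_sigma]
  refine Finset.prod_congr rfl fun i _ => ?_
  rw [map_parts_eq]
  rfl

/-- The map `f` from the cycles of `m` to the cycles of `n` is induced by maps of the blocks which
commute with the permutations and are compatible with the sizes. -/
def IsCycleMap {k : ℕ} {m n : I k} (f : Cyc m → Cyc n) : Prop :=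
  (∀ c, (f c).len ∣ c.len) ∧
    ∀ q, ∑ c with f c = q, c.len * ((c.1 : ℕ) + 1) = q.len * ((q.1 : ℕ) + 1)

/-- The power of `q.len` is written as a product over the fibre of `q`, so that the product over all
`q` becomes a single product over the cycles of `m`. -/
theorem pairing_cycles {k : ℕ} {m n : I k} (f : Cyc m → Cyc n) (q : Cyc n) :
    pairing (plethysm q.len.toPNat' (E ((q.1 : ℕ) + 1)))
      (∑ c, if f c = q then Finsupp.single c.lenSize 1 else 0) =
    if (∀ c, f c = q → q.len ∣ c.len) ∧
        ∑ c with f c = q, c.len * ((c.1 : ℕ) + 1) = q.len * ((q.1 : ℕ) + 1)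
      then ∏ c with f c = q, ((f c).len : ℂ) else 0 := by
  have h1 : (∑ c, if f c = q then Finsupp.single c.lenSize 1 else 0) =
      Multiset.toFinsupp ((Finset.univ.filter fun c => f c = q).val.map Cyc.lenSize) := by
    rw [← Finset.sum_filter, ← Multiset.sum_map_singleton (Multiset.map _ _), Multiset.map_map]
    refine Eq.trans ?_ (map_sum Multiset.toFinsupp
      (fun c : Cyc m => ({c.lenSize} : Multiset (ℕ+ × ℕ+))) (Finset.univ.filter fun c => f c = q)).symm
    simp only [Multiset.toFinsupp_singleton]
  rw [h1, pairing_plethysm_E]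
  have hpos : ∀ {v : I k} (c : Cyc v), ((c.len.toPNat' : ℕ+) : ℕ) = c.len := fun c => by
    rw [Nat.toPNat'_coe, if_pos c.len_pos]
  have h2 : (∀ x ∈ (Finset.univ.filter fun c => f c = q).val.map Cyc.lenSize, q.len.toPNat' ∣ x.1) ↔
      ∀ c, f c = q → q.len ∣ c.len := by
    simp only [Multiset.mem_map, Finset.mem_val, Finset.mem_filter, Finset.mem_univ, true_and,
      forall_exists_index, and_imp, forall_apply_eq_imp_iff₂, PNat.dvd_iff]
    simp only [Cyc.lenSize, hpos]
  have h3 : weight ((Finset.univ.filter fun c => f c = q).val.map Cyc.lenSize) =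
      ∑ c with f c = q, c.len * ((c.1 : ℕ) + 1) := by
    rw [weight, Multiset.map_map]
    refine Finset.sum_congr rfl fun c _ => ?_
    simp only [Function.comp_apply, Cyc.lenSize, hpos, Nat.succPNat_coe, Nat.succ_eq_add_one]
  refine if_congr (and_congr h2 (by rw [h3, hpos])) ?_ rfl
  rw [hpos, Multiset.card_map, Finset.card_val]
  rw [Finset.prod_congr rfl (g := fun _ => (q.len : ℂ))
    (fun c hc => by rw [(Finset.mem_filter.1 hc).2]), Finset.prod_const]

theorem B_mul_z {k : ℕ} (m n : I k) :
    B k n m * z n = ∑ f : Cyc m → Cyc n with IsCycleMap f, ∏ c, ((f c).len : ℂ) := by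
  have hz : (z n : ℂ) ≠ 0 := by
    rw [z_eq]
    exact Nat.cast_ne_zero.2 (zeta_pos _).ne'
  unfold B
  rw [pX_eq, scalar_monomial, pairing_C_mul, mul_right_comm, inv_mul_cancel₀ hz, one_mul,
    toFinsupp_cycles, pE_eq, pairing_prod, Finset.sum_filter]
  refine Finset.sum_congr rfl fun f _ => ?_
  simp only [pairing_cycles]
  split_ifs with h
  · rw [← Finset.prod_fiberwise Finset.univ f]
    refine Finset.prod_congr rfl fun q _ => if_pos ⟨?_, h.2 q⟩
    rintro c rfl
    exact h.1 c
  · obtain ⟨q, hq⟩ : ∃ q, ¬ ((∀ c, f c = q → q.len ∣ c.len) ∧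
        ∑ c with f c = q, c.len * ((c.1 : ℕ) + 1) = q.len * ((q.1 : ℕ) + 1)) := by
      by_contra! h2
      exact h ⟨fun c => (h2 _).1 c rfl, fun q => (h2 q).2⟩
    exact Finset.prod_eq_zero (Finset.mem_univ q) (if_neg hq)

/-! ### Maps between disjoint unions of cycles -/

section CycleMaps

theorem finRotate_mod {n : ℕ} (x : Fin n) (t : ℕ) :
    finRotate n ⟨(x + t) % n, Nat.mod_lt _ x.pos⟩ = ⟨(x + (t + 1)) % n, Nat.mod_lt _ x.pos⟩ := by
  cases n with
  | zero => exact x.elim0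
  | succ n =>
    rw [finRotate_apply]
    refine Fin.ext ?_
    rw [Fin.val_add, Fin.val_one', Nat.mod_add_mod, Nat.add_mod_mod]
    simp [add_assoc]

/-- The rotation of a disjoint union of cycles of lengths `l`. -/
def rot {C : Type*} (l : C → ℕ) : Equiv.Perm (Σ c, Fin (l c)) :=
  Equiv.sigmaCongrRight fun c => finRotate (l c)

theorem rot_pow_apply {C : Type*} (l : C → ℕ) (t : ℕ) (c : C) (x : Fin (l c)) :
    (rot l ^ t) ⟨c, x⟩ = ⟨c, ⟨(x + t) % l c, Nat.mod_lt _ x.pos⟩⟩ := by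
  induction t with
  | zero =>
    rw [pow_zero, Equiv.Perm.one_apply]
    congr 1
    exact Fin.ext (Nat.mod_eq_of_lt x.2).symm
  | succ t ih =>
    rw [pow_succ', Equiv.Perm.mul_apply, ih]
    change (⟨c, finRotate (l c) _⟩ : Σ c, Fin (l c)) = _
    rw [finRotate_mod]

variable {C D : Type*} (l s : C → ℕ) (l' s' : D → ℕ)

/-- Maps which commute with the rotations and are compatible with the sizes. -/
def IsEquivariant [Fintype C] [DecidableEq D] (F : (Σ c, Fin (l c)) → Σ q, Fin (l' q)) : Prop :=
  (∀ y, F (rot l y) = rot l' (F y)) ∧ ∀ z, ∑ y with F y = z, s y.1 = s' z.1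

variable {l s l' s'}

theorem apply_rot_pow {F : (Σ c, Fin (l c)) → Σ q, Fin (l' q)}
    (hF : ∀ y, F (rot l y) = rot l' (F y)) (t : ℕ) (y) :
    F ((rot l ^ t) y) = (rot l' ^ t) (F y) := by
  induction t with
  | zero => rfl
  | succ t ih => rw [pow_succ', pow_succ', Equiv.Perm.mul_apply, Equiv.Perm.mul_apply, hF, ih]

theorem fst_apply_eq {F : (Σ c, Fin (l c)) → Σ q, Fin (l' q)} (hl : ∀ c, 0 < l c)
    (hF : ∀ y, F (rot l y) = rot l' (F y)) (c : C) (x : Fin (l c)) :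
    F ⟨c, x⟩ = (rot l' ^ (x : ℕ)) (F ⟨c, ⟨0, hl c⟩⟩) := by
  rw [← apply_rot_pow hF, rot_pow_apply]
  congr 2
  exact Fin.ext (by simp [Nat.mod_eq_of_lt x.2])

/-- A cycle `c` lies entirely over the cycle `f c`, so it contributes its `l c` points to the cycle
`f c` and to no other. -/
theorem sum_sum_fiber [Fintype C] [DecidableEq D] {F : (Σ c, Fin (l c)) → Σ q, Fin (l' q)} {f : C → D}
    (hf : ∀ c x, (F ⟨c, x⟩).1 = f c) (q : D) :
    ∑ x : Fin (l' q), ∑ y with F y = ⟨q, x⟩, s y.1 = ∑ c with f c = q, l c * s c := by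
  have h1 : ∀ y, (∑ x : Fin (l' q), if F y = ⟨q, x⟩ then s y.1 else 0) =
      if f y.1 = q then s y.1 else 0 := by
    rintro ⟨c, x⟩
    rw [← hf c x]
    generalize F ⟨c, x⟩ = z
    obtain ⟨q', x'⟩ := z
    by_cases h : q' = q
    · subst h
      rw [if_pos rfl, Finset.sum_eq_single x']
      · rw [if_pos rfl]
      · intro b _ hb
        rw [if_neg]
        intro h
        exact hb (eq_of_heq (Sigma.mk.inj h).2).symm
      · simp
    · rw [if_neg h]
      exact Finset.sum_eq_zero fun b _ => if_neg fun h2 => h (congrArg Sigma.fst h2)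
  simp only [Finset.sum_filter]
  rw [Finset.sum_comm]
  simp only [h1]
  rw [Fintype.sum_sigma]
  refine Finset.sum_congr rfl fun c _ => ?_
  refine (Finset.sum_const (if f c = q then s c else 0)).trans ?_
  rw [Finset.card_univ, Fintype.card_fin, smul_eq_mul, mul_ite, mul_zero]

/-- An equivariant map is determined by the images of the starting points of the cycles. A point of
cycle `q` is a possible image for the start of `c` exactly when `l' q ∣ l c`, so a given map `f` of
cycles leaves `l' (f c)` choices for each `c`. -/
theorem card_equivariant [Fintype C] [Fintype D] [DecidableEq C] [DecidableEq D]
    (hl : ∀ c, 0 < l c) (hl' : ∀ q, 0 < l' q) :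
    Nat.card {F // IsEquivariant l s l' s' F} =
      ∑ f : C → D with (∀ c, l' (f c) ∣ l c) ∧ ∀ q, ∑ c with f c = q, l c * s c = l' q * s' q,
        ∏ c, l' (f c) := by
  let P : (C → D) → Prop := fun f =>
    (∀ c, l' (f c) ∣ l c) ∧ ∀ q, ∑ c with f c = q, l c * s c = l' q * s' q
  let y0 : ∀ c, Σ c, Fin (l c) := fun c => ⟨c, ⟨0, hl c⟩⟩
  have hfst : ∀ (t : ℕ) (z : Σ q, Fin (l' q)), ((rot l' ^ t) z).1 = z.1 := by
    rintro t ⟨q, x⟩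
    rw [rot_pow_apply]
  have hfix : ∀ (t : ℕ) (z : Σ q, Fin (l' q)), (rot l' ^ t) z = z ↔ l' z.1 ∣ t := by
    rintro t ⟨q, x⟩
    rw [rot_pow_apply]
    constructor
    · intro h
      have h1 : ((x : ℕ) + t) % l' q = x := congrArg Fin.val (eq_of_heq (Sigma.mk.inj h).2)
      have h2 : (x : ℕ) + 0 ≡ x + t [MOD l' q] := by
        change _ % _ = _ % _
        rw [h1, add_zero, Nat.mod_eq_of_lt x.2]
      exact (Nat.modEq_zero_iff_dvd).1 (Nat.ModEq.add_left_cancel' _ h2).symm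
    · rintro ⟨r, rfl⟩
      congr 1
      exact Fin.ext (by simp [Nat.mod_eq_of_lt x.2])
  have h1 : Nat.card {F // IsEquivariant l s l' s' F} =
      Nat.card {g : C → Σ q, Fin (l' q) // P (fun c => (g c).1)} := by
    refine Nat.card_congr (Equiv.ofBijective (fun F => ⟨fun c => F.1 (y0 c), ?_⟩) ⟨?_, ?_⟩)
    · obtain ⟨F, hF, hs⟩ := F
      have hf : ∀ c x, (F ⟨c, x⟩).1 = (F (y0 c)).1 := fun c x => by
        rw [fst_apply_eq hl hF, hfst]
      refine ⟨fun c => ?_, fun q => ?_⟩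
      · change l' (F (y0 c)).1 ∣ l c
        rw [← hfix, ← apply_rot_pow hF, rot_pow_apply]
        congr 2
        exact Fin.ext (by simp)
      · rw [← sum_sum_fiber hf q]
        simp only [hs, Finset.sum_const, Finset.card_univ, Fintype.card_fin, smul_eq_mul]
    · rintro ⟨F, hF, hs⟩ ⟨F', hF', hs'⟩ h
      have h2 : ∀ c, F (y0 c) = F' (y0 c) := fun c => congrFun (congrArg Subtype.val h) c
      refine Subtype.ext (funext ?_)
      rintro ⟨c, x⟩
      change F ⟨c, x⟩ = F' ⟨c, x⟩
      rw [fst_apply_eq hl hF, fst_apply_eq hl hF']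
      exact congrArg _ (h2 c)
    · rintro ⟨g, hg, hg2⟩
      let F : (Σ c, Fin (l c)) → Σ q, Fin (l' q) := fun y => (rot l' ^ (y.2 : ℕ)) (g y.1)
      have hF : ∀ y, F (rot l y) = rot l' (F y) := by
        rintro ⟨c, x⟩
        have h3 := rot_pow_apply l 1 c x
        rw [pow_one] at h3
        rw [h3]
        change (rot l' ^ ((x + 1) % l c)) (g c) = rot l' ((rot l' ^ (x : ℕ)) (g c))
        rw [← Equiv.Perm.mul_apply, ← pow_succ']
        -- At the end of a cycle the exponent wraps around; the discarded multiple of `l c` is a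
        -- multiple of the target length and acts trivially on `g c`.
        conv_rhs => rw [← Nat.mod_add_div ((x : ℕ) + 1) (l c), pow_add, Equiv.Perm.mul_apply,
          (hfix _ _).2 (Dvd.dvd.mul_right (hg c) _)]
      refine ⟨⟨F, hF, ?_⟩, ?_⟩
      · rintro ⟨q, x⟩
        -- The fibre sums are constant along each target cycle, so the condition on a whole cycle
        -- gives the condition at each of its points after division by `l' q`.
        let S : (Σ q, Fin (l' q)) → ℕ := fun z => ∑ y with F y = z, s y.1
        have h3 : ∀ z, S (rot l' z) = S z := by
          intro z
          refine (Finset.sum_equiv (rot l) ?_ ?_).symm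
          · intro y
            simp only [Finset.mem_filter, Finset.mem_univ, true_and, hF]
            exact ((rot l').injective.eq_iff).symm
          · rintro ⟨c, x⟩ _
            rfl
        have h4 : ∀ (t : ℕ) z, S ((rot l' ^ t) z) = S z := by
          intro t z
          induction t with
          | zero => rfl
          | succ t ih => rw [pow_succ', Equiv.Perm.mul_apply, h3, ih]
        have h5 : ∀ x', S ⟨q, x'⟩ = S ⟨q, ⟨0, hl' q⟩⟩ := by
          intro x'
          rw [← h4 x' ⟨q, ⟨0, hl' q⟩⟩, rot_pow_apply]
          congr 2
          exact Fin.ext (by simp [Nat.mod_eq_of_lt x'.2])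
        have h6 := sum_sum_fiber (F := F) (s := s) (f := fun c => (g c).1)
          (fun c x => hfst _ _) q
        rw [hg2 q] at h6
        have h7 : ∑ x' : Fin (l' q), S ⟨q, x'⟩ = l' q * S ⟨q, x⟩ := by
          simp only [h5, Finset.sum_const, Finset.card_univ, Fintype.card_fin, smul_eq_mul]
        exact Nat.eq_of_mul_eq_mul_left (hl' q) (h7.symm.trans h6)
      · refine Subtype.ext (funext fun c => ?_)
        rfl
  let e : {g : C → Σ q, Fin (l' q) // P (fun c => (g c).1)} ≃ Σ f : {f // P f}, ∀ c, Fin (l' (f.1 c)) :=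
    { toFun := fun g => ⟨⟨fun c => (g.1 c).1, g.2⟩, fun c => (g.1 c).2⟩
      invFun := fun x => ⟨fun c => ⟨x.1.1 c, x.2 c⟩, x.1.2⟩
      left_inv := fun _ => rfl
      right_inv := fun _ => rfl }
  rw [h1, Nat.card_congr e, Nat.card_eq_fintype_card, Fintype.card_sigma]
  simp only [Fintype.card_pi, Fintype.card_fin]
  rw [← Finset.sum_subtype_eq_sum_filter, Finset.subtype_univ]

end CycleMaps

/-! ### Maps between the blocks of representatives -/

/-- The labels of the blocks of the representative of type `type v`. -/
abbrev Label {k : ℕ} (v : I k) : Type := Σ i : Fin k, Fin ((type v).1 i)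

/-- Maps of blocks which commute with the representative permutations and are compatible with the
sizes of the blocks. -/
def IsBlockMap {k : ℕ} {m n : I k} (F : Label m → Label n) : Prop :=
  (∀ y, F (repBlockPerm m y) = repBlockPerm n (F y)) ∧
    ∀ z, ∑ y with F y = z, ((y.1 : ℕ) + 1) = (z.1 : ℕ) + 1

/-- The blocks are the elements of the cycles. -/
def cycEquiv {k : ℕ} (v : I k) : (Σ c : Cyc v, Fin c.len) ≃ Label v :=
  (Equiv.sigmaAssoc fun (i : Fin k) (t : Fin (rows (v.1 i).2).length) =>
    Fin ((rows (v.1 i).2).get t)).trans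
    (Equiv.sigmaCongrRight fun i => (rowComposition (v.1 i).2).blocksFinEquiv)

theorem cycEquiv_rot {k : ℕ} (v : I k) (y) :
    cycEquiv v (rot Cyc.len y) = repBlockPerm v (cycEquiv v y) := by
  obtain ⟨⟨i, t⟩, x⟩ := y
  refine congrArg (Sigma.mk i) ?_
  exact (congrArg (fun y => (rowComposition (v.1 i).2).blocksFinEquiv
    ((Equiv.sigmaCongrRight fun i_1 => finRotate ((rowComposition (v.1 i).2).blocksFun i_1)) y))
      ((rowComposition (v.1 i).2).blocksFinEquiv.symm_apply_apply ⟨t, x⟩)).symm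

theorem card_blockMap {k : ℕ} (m n : I k) :
    Nat.card {F : Label m → Label n // IsBlockMap F} =
      ∑ f : Cyc m → Cyc n with IsCycleMap f, ∏ c, (f c).len := by
  rw [← Nat.card_congr (Equiv.subtypeEquiv ((cycEquiv m).arrowCongr (cycEquiv n))
    (p := IsEquivariant Cyc.len (fun c : Cyc m => (c.1 : ℕ) + 1) Cyc.len
      (fun q : Cyc n => (q.1 : ℕ) + 1)) ?_)]
  · refine (card_equivariant Cyc.len_pos Cyc.len_pos).trans ?_
    refine Finset.sum_congr ?_ fun _ _ => rfl
    ext f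
    rw [Finset.mem_filter, Finset.mem_filter]
    rfl
  · intro F
    refine and_congr ?_ ?_
    · rw [(cycEquiv m).symm.forall_congr_left]
      refine forall_congr' fun y => ?_
      simp only [Equiv.symm_symm, ← cycEquiv_rot, Equiv.arrowCongr_apply, Function.comp_apply,
        Equiv.symm_apply_apply, (cycEquiv n).injective.eq_iff]
    · rw [(cycEquiv n).symm.forall_congr_left]
      refine forall_congr' fun z => ?_
      rw [Equiv.symm_symm]
      refine Eq.congr ?_ rfl
      refine Finset.sum_equiv (cycEquiv m) (fun y => ?_) (fun _ _ => rfl)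
      simp only [Finset.mem_filter, Finset.mem_univ, true_and, Equiv.arrowCongr_apply,
        Function.comp_apply, Equiv.symm_apply_apply, (cycEquiv n).injective.eq_iff]

theorem B_mul_z_eq_card {k : ℕ} (m n : I k) :
    B k n m * z n = (Nat.card {F : Label m → Label n // IsBlockMap F} : ℂ) := by
  rw [B_mul_z, card_blockMap]
  push_cast
  rfl

/-! ### The automorphisms of the blocks of a representative -/

/-- The centralizer formula treats fixed points separately from the cycle type, while in `zPtn` they
are the parts equal to 1; the part 1 is split off to compare the two. -/
theorem card_centralizer_eq_zPtn {p : Ptn} (σ : Equiv.Perm (Fin p.1))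
    (h : σ.partition.parts = p.2.parts) : Nat.card (Subgroup.centralizer {σ}) = zPtn p := by
  have h1 : (1 : ℕ) ∉ σ.cycleType.toFinset := fun h =>
    absurd (Equiv.Perm.two_le_of_mem_cycleType (Multiset.mem_toFinset.1 h)) (by norm_num)
  have h0 : σ.cycleType.count 1 = 0 :=
    Multiset.count_eq_zero_of_notMem fun h => h1 (Multiset.mem_toFinset.2 h)
  have hsub : p.2.parts.toFinset ⊆ insert 1 σ.cycleType.toFinset := by
    intro x hx
    rw [Multiset.mem_toFinset, ← h, Equiv.Perm.parts_partition, Multiset.mem_add] at hx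
    rcases hx with hx | hx
    · exact Finset.mem_insert_of_mem (Multiset.mem_toFinset.2 hx)
    · rw [Multiset.eq_of_mem_replicate hx]
      exact Finset.mem_insert_self _ _
  unfold zPtn
  rw [Finset.prod_subset hsub fun x _ hx => by
    rw [Multiset.count_eq_zero_of_notMem fun h => hx (Multiset.mem_toFinset.2 h)]
    rfl]
  rw [Equiv.Perm.nat_card_centralizer, Finset.prod_insert h1, ← h, Equiv.Perm.parts_partition,
    Equiv.Perm.sum_cycleType, Multiset.count_add, Multiset.count_replicate_self, h0, zero_add,
    one_pow, one_mul, mul_assoc, Finset.prod_multiset_count, ← Finset.prod_mul_distrib]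
  congr 1
  refine Finset.prod_congr rfl fun x hx => ?_
  have hx1 : x ≠ 1 := fun h => h1 (h ▸ hx)
  rw [Multiset.count_add, Multiset.count_replicate, if_neg (Ne.symm hx1), add_zero]

/-- The permutations of the blocks of a representative which commute with the representative
permutation and preserve the sizes of the blocks. -/
abbrev BlockAut {k : ℕ} (n : I k) : Type :=
  {α : Equiv.Perm (Label n) // (∀ y, α (repBlockPerm n y) = repBlockPerm n (α y)) ∧
    ∀ y, (α y).1 = y.1}

/-- Preserving sizes splits an automorphism into one permutation for each size, each centralizing
the corresponding representative permutation. -/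
theorem card_blockAut {k : ℕ} (n : I k) : Nat.card (BlockAut n) = z n := by
  have h1 : ∀ i, Nat.card (Subgroup.centralizer {repPerm (n.1 i).2}) = zPtn (n.1 i) := fun i =>
    card_centralizer_eq_zPtn _ (partition_parts_repPerm _)
  unfold z
  simp only [← h1]
  rw [← Nat.card_pi]
  let Φ : (∀ i, Subgroup.centralizer {repPerm (n.1 i).2}) → BlockAut n := fun c =>
    ⟨Equiv.Perm.sigmaCongrRight fun i => (c i).1, by
      rintro ⟨i, x⟩
      have h2 := Subgroup.mem_centralizer_singleton_iff.1 (c i).2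
      exact congrArg (Sigma.mk i) (DFunLike.congr_fun h2 x), fun _ => rfl⟩
  refine (Nat.card_congr (Equiv.ofBijective Φ ⟨?_, ?_⟩)).symm
  · intro c c' h
    have h2 := Equiv.Perm.sigmaCongrRightHom_injective (β := fun i => Fin (n.1 i).1)
      (a₁ := fun i => (c i).1) (a₂ := fun i => (c' i).1) (congrArg Subtype.val h)
    funext i
    exact Subtype.ext (congrFun h2 i)
  · rintro ⟨α, hα, hs⟩
    have h2 : ∀ i x, ∃ y, α ⟨i, x⟩ = ⟨i, y⟩ := by
      intro i x
      have h3 := hs ⟨i, x⟩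
      generalize α ⟨i, x⟩ = w at h3
      obtain ⟨j, y⟩ := w
      obtain rfl : j = i := h3
      exact ⟨y, rfl⟩
    choose f hf using h2
    have hinj : ∀ i, Function.Injective (f i) := by
      intro i x y h
      have h3 : α ⟨i, x⟩ = α ⟨i, y⟩ := by rw [hf, hf, h]
      exact eq_of_heq (Sigma.mk.inj (α.injective h3)).2
    let c : ∀ i, Equiv.Perm (Fin (n.1 i).1) := fun i =>
      Equiv.ofBijective (f i) (Finite.injective_iff_bijective.1 (hinj i))
    refine ⟨fun i => ⟨c i, Subgroup.mem_centralizer_singleton_iff.2 ?_⟩, ?_⟩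
    · refine Equiv.ext fun x => ?_
      have h3 := hα ⟨i, x⟩
      have h4 : α ⟨i, repPerm (n.1 i).2 x⟩ = ⟨i, repPerm (n.1 i).2 (f i x)⟩ :=
        h3.trans (congrArg _ (hf i x))
      exact eq_of_heq (Sigma.mk.inj ((hf i _).symm.trans h4)).2
    · refine Subtype.ext (Equiv.ext ?_)
      rintro ⟨i, x⟩
      exact (hf i x).symm

/-! ### Mergings of representatives and maps of blocks -/

instance finite_U {k : ℕ} : Finite (U k) := by
  refine Finite.of_injective (fun (d : U k) (x y : Fin k ⊕ Fin k) => d.rel x y) fun d e h => ?_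
  refine U.ext ?_
  ext x y
  exact (congrFun (congrFun h x) y).to_iff

section Mergings

variable {k : ℕ} {m n : I k}

theorem ncard_fiber_comp {A Z : Type*} [Fintype A] [DecidableEq Z] {f : Fin k → A} (g : A → Z)
    (w : Z) :
    {x | g (f x) = w}.ncard = ∑ y with g y = w, {x | f x = y}.ncard := by
  rw [Set.ncard_eq_toFinset_card', Finset.card_eq_sum_card_fiberwise (f := f)
    (t := Finset.univ.filter fun y => g y = w)]
  · refine Finset.sum_congr rfl fun y hy => ?_
    rw [Set.ncard_eq_toFinset_card']
    congr 1
    ext x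
    simp only [Finset.mem_filter, Finset.mem_univ, true_and, Set.mem_toFinset,
      Set.mem_ofPred_eq] at hy ⊢
    constructor
    · exact fun h => h.2
    · rintro rfl
      exact ⟨hy, rfl⟩
  · intro x hx
    simpa using hx

theorem isLabelling_comp_iff (F : Label m → Label n) :
    IsLabelling (F ∘ blockOf (type m)) ↔
      ∀ w, ∑ y with F y = w, ((y.1 : ℕ) + 1) = (w.1 : ℕ) + 1 := by
  refine forall_congr' fun w => ?_
  have h := ncard_fiber_comp (f := blockOf (type m)) F w
  simp only [ncard_blockOf] at h
  rw [← h]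
  rfl

theorem IsBlockMap.surjective {F : Label m → Label n} (h : IsBlockMap F) :
    Function.Surjective F :=
  Function.Surjective.of_comp ((isLabelling_comp_iff F).2 h.2).surjective

theorem elim_comp_eq {F : Label m → Label n} (h : IsBlockMap F) :
    Sum.elim (repBlockPerm n ∘ F ∘ blockOf (type m)) (F ∘ blockOf (type m)) =
      F ∘ Sum.elim (repBlockPerm m ∘ blockOf (type m)) (blockOf (type m)) := by
  funext x
  rcases x with x | x
  · exact (h.1 _).symm
  · rfl

/-- The diagram obtained from the representative of cycle type `m` by merging blocks which are mapped
to the same label. -/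
def mergeOf (F : {F : Label m → Label n // IsBlockMap F}) : U k :=
  ofLabels (repBlockPerm n ∘ F.1 ∘ blockOf (type m)) (F.1 ∘ blockOf (type m)) (by
    have h1 := (isLabelling_comp_iff F.1).2 F.2.2
    intro w
    refine Eq.trans ?_ ((h1 ((repBlockPerm n).symm w)).trans (h1 w).symm)
    congr 1
    ext x
    exact (Equiv.eq_symm_apply _).symm)

theorem mergeOf_mem (F : {F : Label m → Label n // IsBlockMap F}) :
    mergeOf F ∈ mergings (rep m) n := by
  refine mem_mergings_iff.2 ⟨?_, _, (isLabelling_comp_iff F.1).2 F.2.2, rfl⟩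
  intro x y hxy
  change Sum.elim (repBlockPerm n ∘ F.1 ∘ blockOf (type m)) (F.1 ∘ blockOf (type m)) x =
    Sum.elim (repBlockPerm n ∘ F.1 ∘ blockOf (type m)) (F.1 ∘ blockOf (type m)) y
  rw [elim_comp_eq F.2]
  exact congrArg F.1 hxy

/-- A labelling of a coarser diagram is constant on the blocks of `rep m`, hence factors through
`blockOf`; the blocks of `rep m` joining its two rows make the factor equivariant. -/
theorem exists_mergeOf_eq {d : U k} (hd : d ∈ mergings (rep m) n) :
    ∃ F : {F : Label m → Label n // IsBlockMap F}, mergeOf F = d := by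
  obtain ⟨hle, f, hf, hrel⟩ := mem_mergings_iff.1 hd
  have hs := (isLabelling_blockOf (type m)).surjective
  let b := Function.surjInv hs
  have hb : ∀ y, blockOf (type m) (b y) = y := Function.surjInv_eq hs
  have hF : (f ∘ b) ∘ blockOf (type m) = f := by
    funext x
    have h1 : (rep m).rel (Sum.inr (b (blockOf (type m) x))) (Sum.inr x) := hb _
    have h2 := hle h1
    rw [hrel] at h2
    exact h2
  have hblock : IsBlockMap (f ∘ b) := by
    refine ⟨fun y => ?_, (isLabelling_comp_iff _).1 (hF.symm ▸ hf)⟩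
    have h1 : (rep m).rel (Sum.inl (b y)) (Sum.inr (b (repBlockPerm m y))) :=
      (congrArg (repBlockPerm m) (hb y)).trans (hb _).symm
    have h2 := hle h1
    rw [hrel] at h2
    exact h2.symm
  refine ⟨⟨f ∘ b, hblock⟩, U.ext ?_⟩
  change Setoid.ker (Sum.elim (repBlockPerm n ∘ (f ∘ b) ∘ blockOf (type m))
    ((f ∘ b) ∘ blockOf (type m))) = _
  rw [hF, hrel]

theorem mergeOf_rel (F : {F : Label m → Label n // IsBlockMap F}) : (mergeOf F).rel =
    Setoid.ker (F.1 ∘ Sum.elim (repBlockPerm m ∘ blockOf (type m)) (blockOf (type m))) := by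
  rw [← elim_comp_eq F.2]
  rfl

theorem mergeOf_eq_iff (F F' : {F : Label m → Label n // IsBlockMap F}) :
    mergeOf F = mergeOf F' ↔ Setoid.ker F.1 = Setoid.ker F'.1 := by
  rw [U.ext_iff, mergeOf_rel, mergeOf_rel]
  have hs : Function.Surjective
      (Sum.elim (repBlockPerm m ∘ blockOf (type m)) (blockOf (type m))) := fun y => by
    obtain ⟨x, hx⟩ := (isLabelling_blockOf (type m)).surjective y
    exact ⟨Sum.inr x, hx⟩
  constructor
  · intro h
    ext y y'
    obtain ⟨x, rfl⟩ := hs y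
    obtain ⟨x', rfl⟩ := hs y'
    exact Setoid.ext_iff.1 h x x'
  · intro h
    ext x x'
    exact Setoid.ext_iff.1 h _ _

/-- The automorphisms of the blocks of `n` act by composition on block maps. The action is free
because block maps are surjective, and its orbits are the fibres of `mergeOf`, since maps with equal
kernels differ by an automorphism. With one map `F0 d` fixed over each merging, every block map is
uniquely `α ∘ F0 d`. -/
theorem card_blockMap_eq_mul (m n : I k) :
    Nat.card {F : Label m → Label n // IsBlockMap F} = (mergings (rep m) n).ncard * z n := by
  rw [← card_blockAut, ← Nat.card_coe_set_eq, ← Nat.card_prod]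
  have h0 : ∀ d : mergings (rep m) n, ∃ F : {F : Label m → Label n // IsBlockMap F},
    mergeOf F = d.1 := fun d => exists_mergeOf_eq d.2
  choose F0 hF0 using h0
  have hmap : ∀ (F : {F : Label m → Label n // IsBlockMap F}) (α : BlockAut n),
      IsBlockMap (α.1 ∘ F.1) := by
    rintro ⟨F, hF, hs⟩ ⟨α, hα, hα2⟩
    refine ⟨fun y => ?_, fun w => ?_⟩
    · change α (F _) = repBlockPerm n (α (F y))
      rw [hF, hα]
    · have h1 : (α.symm w).1 = w.1 := by rw [← hα2, Equiv.apply_symm_apply]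
      rw [← h1, ← hs]
      refine Finset.sum_congr ?_ fun _ _ => rfl
      ext y
      simp only [Finset.mem_filter, Finset.mem_univ, true_and, Equiv.eq_symm_apply]
      rfl
  refine (Nat.card_congr (Equiv.ofBijective
    (fun x : mergings (rep m) n × BlockAut n =>
      (⟨x.2.1 ∘ (F0 x.1).1, hmap _ _⟩ : {F : Label m → Label n // IsBlockMap F})) ⟨?_, ?_⟩)).symm
  · rintro ⟨d, α⟩ ⟨d', α'⟩ h
    have h1 : α.1 ∘ (F0 d).1 = α'.1 ∘ (F0 d').1 := congrArg Subtype.val h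
    have h2 : ∀ (α : BlockAut n) (f : Label m → Label n),
        Setoid.ker (α.1 ∘ f) = Setoid.ker f := fun α f => by
      ext x y
      exact α.1.injective.eq_iff
    have h3 : d = d' := by
      refine Subtype.ext ?_
      rw [← hF0, ← hF0, mergeOf_eq_iff, ← h2 α, h1, h2]
    subst h3
    have h4 : α = α' := by
      refine Subtype.ext (Equiv.ext fun w => ?_)
      obtain ⟨y, rfl⟩ := (F0 d).2.surjective w
      exact congrFun h1 y
    rw [h4]
  · intro F
    let d : mergings (rep m) n := ⟨mergeOf F, mergeOf_mem F⟩
    have hk : Setoid.ker (F0 d).1 = Setoid.ker F.1 := (mergeOf_eq_iff _ _).1 (hF0 d)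
    have hk2 : ∀ y y', (F0 d).1 y = (F0 d).1 y' ↔ F.1 y = F.1 y' := Setoid.ext_iff.1 hk
    -- `F` and `F0 d` have the same kernel, so `F` after a section of `F0 d` is a bijection not
    -- depending on the section.
    let b := Function.surjInv (F0 d).2.surjective
    have hb : ∀ w, (F0 d).1 (b w) = w := Function.surjInv_eq _
    have hb2 : ∀ y, F.1 (b ((F0 d).1 y)) = F.1 y := fun y => (hk2 _ _).1 (hb _)
    have hbij : Function.Bijective (F.1 ∘ b) := by
      constructor
      · intro w w' h
        rw [← hb w, ← hb w']
        exact (hk2 _ _).2 h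
      · intro w
        obtain ⟨y, rfl⟩ := F.2.surjective w
        exact ⟨_, hb2 y⟩
    refine ⟨⟨d, ⟨Equiv.ofBijective _ hbij, ?_, ?_⟩⟩, Subtype.ext (funext hb2)⟩
    · intro w
      obtain ⟨y, rfl⟩ := (F0 d).2.surjective w
      change F.1 (b _) = repBlockPerm n (F.1 (b _))
      rw [← (F0 d).2.1, hb2, hb2, F.2.1]
    · intro w
      -- Corresponding labels have the same fibre, and the size of a label is the total size of its
      -- fibre.
      have h1 := F.2.2 (F.1 (b w))
      have h2 := (F0 d).2.2 w
      refine Fin.ext (Nat.succ_injective ?_)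
      change ((F.1 (b w)).1 : ℕ) + 1 = (w.1 : ℕ) + 1
      rw [← h1, ← h2]
      refine Finset.sum_congr ?_ fun _ _ => rfl
      ext y
      simp only [Finset.mem_filter, Finset.mem_univ, true_and, ← hk2, hb]

theorem z_ne_zero (n : I k) : (z n : ℂ) ≠ 0 := by
  rw [z_eq]
  exact Nat.cast_ne_zero.2 (zeta_pos _).ne'

theorem B_eq_ncard_mergings (n m : I k) : B k n m = ((mergings (rep m) n).ncard : ℂ) := by
  refine mul_right_cancel₀ (z_ne_zero n) ?_
  rw [B_mul_z_eq_card, card_blockMap_eq_mul]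
  push_cast
  rfl

end Mergings

/-! ### Triangularity -/

theorem sort_map_eq_cons {X : Type*} [DecidableEq X] (f : X → ℕ) (R : Finset X) (x : X) (hx : x ∈ R)
    (hmax : ∀ x' ∈ R, f x' ≤ f x) :
    (R.val.map f).sort (· ≥ ·) = f x :: ((R.erase x).val.map f).sort (· ≥ ·) := by
  rw [← Multiset.sort_cons]
  · rw [← Multiset.map_cons, Finset.erase_val, Multiset.cons_erase hx]
  · intro b hb
    obtain ⟨x', hx', rfl⟩ := Multiset.mem_map.1 hb
    exact hmax x' (Finset.mem_of_mem_erase hx')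

/-- Summing parts in groups cannot decrease the largest part. If it grows, the first entries decide;
if not, the largest part of `S` is alone in its group, and it is removed together with its image. -/
theorem rlKey_sort_le {Y Z : Type*} [DecidableEq Z] {s : Y → ℕ} {s' : Z → ℕ} (hs : ∀ y, 0 < s y)
    (hs' : ∀ w, 0 < s' w) (F : Y → Z) (S : Finset Y) (T : Finset Z) (hST : ∀ y ∈ S, F y ∈ T)
    (hsum : ∀ w ∈ T, ∑ y ∈ S with F y = w, s y = s' w) :
    rlKey ((T.val.map s').sort (· ≥ ·)) ≤ rlKey ((S.val.map s).sort (· ≥ ·)) := by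
  induction hn : S.card generalizing S T with
  | zero =>
    obtain rfl := Finset.card_eq_zero.1 hn
    obtain rfl : T = ∅ := by
      refine Finset.eq_empty_of_forall_notMem fun w hw => (hs' w).ne ?_
      rw [← hsum w hw]
      simp
    exact le_refl _
  | succ N ih =>
    have hS : S.Nonempty := Finset.card_pos.1 (hn ▸ Nat.succ_pos N)
    obtain ⟨y, hy, hymax⟩ := S.exists_max_image s hS
    obtain ⟨w, hw, hwmax⟩ := T.exists_max_image s' ⟨F y, hST y hy⟩
    have hle : ∀ y ∈ S, s y ≤ s' (F y) := fun y hy => by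
      rw [← hsum _ (hST y hy)]
      exact Finset.single_le_sum (f := s) (fun _ _ => Nat.zero_le _)
        (Finset.mem_filter.2 ⟨hy, rfl⟩)
    rw [sort_map_eq_cons s S y hy hymax]
    rcases ((hle y hy).trans (hwmax _ (hST y hy))).lt_or_eq with hlt | heq
    · rw [sort_map_eq_cons s' T w hw hwmax]
      -- The entries of the keys are in the dual order, so the larger first part gives the smaller
      -- key.
      exact le_of_lt (List.Lex.rel hlt)
    · have heq2 : s y = s' (F y) := le_antisymm (hle y hy) (heq ▸ hwmax _ (hST y hy))
      rw [sort_map_eq_cons s' T (F y) (hST y hy) (fun x hx => heq2 ▸ heq ▸ hwmax x hx), ← heq2]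
      have hfib : ∀ y' ∈ S, F y' = F y → y' = y := by
        intro y' hy' h
        by_contra hne
        have h1 := hsum _ (hST y hy)
        have h2 : s y + s y' ≤ ∑ x ∈ S with F x = F y, s x := by
          rw [← Finset.sum_pair (Ne.symm hne)]
          refine Finset.sum_le_sum_of_subset ?_
          intro x hx
          rcases Finset.mem_insert.1 hx with rfl | hx
          · exact Finset.mem_filter.2 ⟨hy, rfl⟩
          · rw [Finset.mem_singleton.1 hx]
            exact Finset.mem_filter.2 ⟨hy', h⟩
        have := hs y'
        omega
      have h3 := ih (S.erase y) (T.erase (F y))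
        (fun y' hy' => Finset.mem_erase.2 ⟨fun h => Finset.ne_of_mem_erase hy'
          (hfib y' (Finset.mem_of_mem_erase hy') h), hST y' (Finset.mem_of_mem_erase hy')⟩)
        (fun w' hw' => by
          rw [← hsum w' (Finset.mem_of_mem_erase hw')]
          refine Finset.sum_congr ?_ fun _ _ => rfl
          ext x
          simp only [Finset.mem_filter, Finset.mem_erase]
          constructor
          · exact fun h => ⟨h.1.2, h.2⟩
          · rintro ⟨h1, rfl⟩
            refine ⟨⟨?_, h1⟩, rfl⟩
            rintro rfl
            exact Finset.ne_of_mem_erase hw' rfl)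
        (by rw [Finset.card_erase_of_mem hy, hn]; rfl)
      exact List.cons_le_cons _ h3

section Triangular

variable {k : ℕ} {m n : I k}

theorem rows_type (v : I k) : (type v).rows =
    ((Finset.univ : Finset (Label v)).val.map fun y => (y.1 : ℕ) + 1).sort (· ≥ ·) := by
  unfold ExpPtn.rows
  congr 1
  rw [← Multiset.sum_map_singleton (Multiset.map _ _), Multiset.map_map]
  refine Eq.trans ?_ (Fintype.sum_sigma (fun y : Label v => ({(y.1 : ℕ) + 1} : Multiset ℕ))).symm
  refine Finset.sum_congr rfl fun i _ => ?_
  refine Eq.trans ?_ (Finset.sum_const ({(i : ℕ) + 1} : Multiset ℕ)).symm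
  rw [Finset.card_univ, Fintype.card_fin, Multiset.nsmul_singleton]

theorem eq_of_injective {F : Label m → Label n} (hF : IsBlockMap F) (hinj : Function.Injective F) :
    n = m ∧ mergeOf ⟨F, hF⟩ = rep m := by
  have h1 : mergeOf ⟨F, hF⟩ = rep m := by
    refine U.ext ?_
    rw [mergeOf_rel]
    ext x y
    exact hinj.eq_iff
  obtain ⟨-, h2, h3⟩ := mergeOf_mem ⟨F, hF⟩
  rw [← Subtype.val_injective.eq_iff, ← h3]
  refine ⟨?_, h1⟩
  generalize mergeOf ⟨F, hF⟩ = d at *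
  subst h1
  exact cycleType_rep m _

/-- Equal types have equal numbers of blocks, and a block map is surjective. -/
theorem injective_of_rows_eq {F : Label m → Label n} (hF : IsBlockMap F)
    (h : (type n).rows = (type m).rows) : Function.Injective F := by
  have h1 := congrArg List.length h
  rw [rows_type, rows_type, Multiset.length_sort, Multiset.length_sort, Multiset.card_map,
    Multiset.card_map, Finset.card_val, Finset.card_val, Finset.card_univ, Finset.card_univ] at h1
  exact ((Fintype.bijective_iff_surjective_and_card F).2 ⟨hF.surjective, h1.symm⟩).1

/-- The types decide unless they agree; in that case the map is bijective, nothing is merged and `n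
= m`. The second stage of the order is never consulted. -/
theorem IsBlockMap.le {F : Label m → Label n} (hF : IsBlockMap F) : n ≤ m := by
  have h1 : rlKey (type n).rows ≤ rlKey (type m).rows := by
    rw [rows_type, rows_type]
    exact rlKey_sort_le (s := fun y : Label m => (y.1 : ℕ) + 1)
      (s' := fun w : Label n => (w.1 : ℕ) + 1) (fun _ => Nat.succ_pos _)
      (fun _ => Nat.succ_pos _) F _ _
      (fun _ _ => Finset.mem_univ _) (fun w _ => hF.2 w)
  rcases h1.lt_or_eq with h | h
  · exact Prod.Lex.toLex_le_toLex.2 (Or.inl h)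
  · have h2 : (type n).rows = (type m).rows :=
      List.map_injective_iff.2 OrderDual.toDual.injective h
    exact (eq_of_injective hF (injective_of_rows_eq hF h2)).1.le

theorem mergings_rep_self (n : I k) : mergings (rep n) n = {rep n} := by
  ext d
  constructor
  · intro h
    obtain ⟨F, rfl⟩ := exists_mergeOf_eq h
    exact (eq_of_injective F.2 (injective_of_rows_eq F.2 rfl)).2
  · rintro rfl
    exact mem_mergings_iff.2 ⟨le_refl _, _, isLabelling_blockOf (type n), rfl⟩

theorem B_blockTriangular (k : ℕ) : (B k).BlockTriangular id := by
  intro n m h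
  rw [B_eq_ncard_mergings, Nat.cast_eq_zero, Set.ncard_eq_zero (Set.toFinite _),
    Set.eq_empty_iff_forall_notMem]
  intro d hd
  obtain ⟨F, -⟩ := exists_mergeOf_eq hd
  exact absurd h (not_lt.2 F.2.le)

theorem B_self (n : I k) : B k n n = 1 := by
  rw [B_eq_ncard_mergings, mergings_rep_self, Set.ncard_singleton, Nat.cast_one]

end Triangular

/-! ### Characters of the maximal subgroups -/

instance finite_specht {n : ℕ} (p : n.Partition) (α : Type) [Fintype α] :
    Module.Finite ℂ (Specht p α) :=
  Module.Finite.iff_fg.2 (Submodule.fg_span (Set.finite_range _))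

/-- The tensor product of the Specht modules as a representation of the product of the symmetric
groups. -/
def permRep {k : ℕ} (π : Setoid (Fin k)) (v : I k) :
    Representation ℂ (∀ i, Equiv.Perm (Block π i)) (V π v) :=
  PiTensorProduct.mapMonoidHom.comp
    (MonoidHom.pi fun i => (spechtRep (v.1 i).2 (Block π i)).comp (Pi.evalMonoidHom _ i))

/-- Elements of equal cycle type are conjugate block size by block size in the product of symmetric
groups. The representation factors through that product, so the conjugating permutations need not be
lifted to `G π`. -/
theorem character_groupRep_eq {k : ℕ} {π : Setoid (Fin k)} (v : I k) {g h : G π}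
    (hgh : cycleType g = cycleType h) :
    (groupRep π v).character g = (groupRep π v).character h := by
  have h1 : ∀ i, ∃ c : Equiv.Perm (Block π i), c * blockPerm π i g * c⁻¹ = blockPerm π i h := by
    intro i
    refine isConj_iff.1 (Equiv.Perm.partition_eq_of_isConj.2 ?_)
    exact eq_of_heq (Sigma.mk.inj (congrFun hgh i)).2
  choose c hc using h1
  have h2 : ∀ g : G π, (groupRep π v).character g =
      (permRep π v).character fun i => blockPerm π i g := fun _ => rfl
  rw [h2, h2, ← (permRep π v).char_conj (fun i => blockPerm π i g) c]
  exact congrArg _ (funext hc)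

/-! ### Characters of induced representations -/

section Induced

variable {k : ℕ} {π : Setoid (Fin k)}

theorem mul_flip (d : U k) : d * flip d = idem d.top := by
  have h : flip (flip d) = d := U.ext_sat fun S T => by rw [sat_flip, sat_flip]
  have h2 := flip_mul (flip d)
  rwa [h] at h2

/-- The element `g` of the maximal subgroup with `l g = l'`. -/
def ratio (l l' : L π) (h : l'.1.top = l.1.top) : G π :=
  ⟨flip l.1 * l'.1, (top_mul (d := flip l.1) (e := l'.1) h.symm).trans l.2,
    (bot_mul (d := flip l.1) (e := l'.1) h.symm).trans l'.2⟩

theorem act_ratio (l l' : L π) (h : l'.1.top = l.1.top) : act l (ratio l l' h) = l' := by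
  refine Subtype.ext ?_
  change l.1 * (flip l.1 * l'.1) = l'.1
  rw [← mul_assoc, mul_flip, ← h, idem_mul]

theorem top_act (l : L π) (g : G π) : (act l g).1.top = l.1.top := top_mul (l.2.trans g.2.1.symm)

theorem ratio_act (l l' : L π) (g : G π) (h : l'.1.top = l.1.top) :
    ratio l (act l' g) ((top_act l' g).trans h) = ratio l l' h * g :=
  Subtype.ext (mul_assoc (flip l.1) l'.1 g.1).symm

/-- The set partitions which occur as the top of an element of the `𝓛`-class. -/
abbrev Tops (π : Setoid (Fin k)) : Type := {σ : Setoid (Fin k) // ∃ l : L π, l.1.top = σ}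

instance : Finite (Tops π) :=
  Finite.of_surjective (fun l : L π => (⟨l.1.top, l, rfl⟩ : Tops π)) fun σ => by
    obtain ⟨σ, l, rfl⟩ := σ
    exact ⟨l, rfl⟩

instance : Fintype (Tops π) := Fintype.ofFinite _

/-- An element of the `𝓛`-class with the given top. -/
def repOfTop (σ : Tops π) : L π := σ.2.choose

theorem top_repOfTop (σ : Tops π) : (repOfTop σ).1.top = σ.1 := σ.2.choose_spec

variable {V : Type} [AddCommGroup V] [Module ℂ V] (ρ : Representation ℂ (G π) V)

/-- The inclusion of the component of the induced representation at `σ`. -/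
def component (σ : Tops π) : V →ₗ[ℂ] Ind ρ :=
  (tensorRel ρ).mkQ.comp (Finsupp.lsingle (repOfTop σ))

/-- The projection to the component of the induced representation at `σ`. -/
def preCoordinate (σ : Tops π) : (L π →₀ V) →ₗ[ℂ] V :=
  Finsupp.lsum ℂ fun l : L π =>
    if h : l.1.top = (repOfTop σ).1.top then ρ (ratio (repOfTop σ) l h) else 0

theorem preCoordinate_single (σ : Tops π) (l : L π) (v : V) :
    preCoordinate ρ σ (Finsupp.single l v) =
      if h : l.1.top = (repOfTop σ).1.top then ρ (ratio (repOfTop σ) l h) v else 0 := by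
  unfold preCoordinate
  rw [Finsupp.lsum_single]
  split_ifs <;> rfl

/-- The projection to the component of the induced representation at `σ`. -/
def coordinate (σ : Tops π) : Ind ρ →ₗ[ℂ] V :=
  (tensorRel ρ).liftQ (preCoordinate ρ σ) (by
    refine Submodule.span_le.2 ?_
    rintro _ ⟨l, g, v, rfl⟩
    rw [SetLike.mem_coe, LinearMap.mem_ker, map_sub, preCoordinate_single, preCoordinate_single]
    by_cases h : l.1.top = (repOfTop σ).1.top
    · rw [dif_pos h, dif_pos ((top_act l g).trans h), ratio_act _ _ _ h, map_mul,
        Module.End.mul_apply, sub_self]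
    · rw [dif_neg h, dif_neg (fun h2 => h ((top_act l g).symm.trans h2)), sub_self])

theorem mk_single_act (l : L π) (g : G π) (v : V) :
    (tensorRel ρ).mkQ (Finsupp.single (act l g) v) =
      (tensorRel ρ).mkQ (Finsupp.single l (ρ g v)) := by
  rw [← sub_eq_zero, ← map_sub, Submodule.mkQ_apply, Submodule.Quotient.mk_eq_zero]
  exact Submodule.subset_span ⟨l, g, v, rfl⟩

/-- The resolution of the identity by the copies of `V`. It is all that the trace computation needs;
independence of the copies plays no role. -/
theorem sum_component_comp_coordinate :
    ∑ σ : Tops π, (component ρ σ).comp (coordinate ρ σ) = LinearMap.id := by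
  refine Submodule.linearMap_qext _ (Finsupp.lhom_ext fun l v => ?_)
  have h1 : ∀ σ : Tops π, (component ρ σ) ((coordinate ρ σ)
      ((tensorRel ρ).mkQ (Finsupp.single l v))) =
      if (⟨l.1.top, l, rfl⟩ : Tops π) = σ then (tensorRel ρ).mkQ (Finsupp.single l v) else 0 := by
    intro σ
    have h2 : coordinate ρ σ ((tensorRel ρ).mkQ (Finsupp.single l v)) =
      preCoordinate ρ σ (Finsupp.single l v) := rfl
    rw [h2, preCoordinate_single]
    by_cases h : l.1.top = (repOfTop σ).1.top
    · rw [dif_pos h, if_pos (Subtype.ext (h.trans (top_repOfTop σ)))]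
      conv_rhs => rw [← act_ratio (repOfTop σ) l h, mk_single_act]
      rfl
    · rw [dif_neg h, map_zero, if_neg]
      rintro rfl
      exact h (top_repOfTop (⟨l.1.top, l, rfl⟩ : Tops π)).symm
  rw [LinearMap.comp_apply, LinearMap.sum_apply]
  simp only [LinearMap.comp_apply, h1, LinearMap.id_apply, Finset.sum_ite_eq, Finset.mem_univ,
    if_true]

instance [Module.Finite ℂ V] : Module.Finite ℂ (Ind ρ) :=
  Module.Finite.of_surjective (tensorRel ρ).mkQ (Submodule.mkQ_surjective _)

/-- Inserting the resolution of the identity and using that the trace of a product is cyclic leaves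
the traces of the diagonal blocks on `V`. -/
theorem character_indRep [Module.Finite ℂ V] (m : U k) :
    (indRep ρ).character m = ∑ σ : Tops π,
      if h : (m * (repOfTop σ).1).bot = π ∧ (m * (repOfTop σ).1).top = (repOfTop σ).1.top then
        ρ.character (ratio (repOfTop σ) ⟨m * (repOfTop σ).1, h.1⟩ h.2) else 0 := by
  have h1 : indRep ρ m = ∑ σ : Tops π,
      (indRep ρ m).comp ((component ρ σ).comp (coordinate ρ σ)) := by
    conv_lhs => rw [← LinearMap.comp_id (indRep ρ m), ← sum_component_comp_coordinate]
    exact LinearMap.ext fun x => by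
      simp only [LinearMap.comp_apply, LinearMap.sum_apply, map_sum]
  change LinearMap.trace ℂ _ (indRep ρ m) = _
  rw [h1, map_sum]
  refine Finset.sum_congr rfl fun σ _ => ?_
  rw [← LinearMap.comp_assoc, LinearMap.trace_comp_comm']
  have h2 : ∀ v, (coordinate ρ σ) (indRep ρ m (component ρ σ v)) =
      preCoordinate ρ σ (preAct π V m (Finsupp.single (repOfTop σ) v)) := fun _ => rfl
  split_ifs with h
  · change _ = LinearMap.trace ℂ _ _
    congr 1
    refine LinearMap.ext fun v => ?_
    rw [LinearMap.comp_apply, LinearMap.comp_apply, h2, preAct_single, dif_pos h.1,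
      preCoordinate_single, dif_pos h.2]
  · rw [show (coordinate ρ σ).comp ((indRep ρ m).comp (component ρ σ)) = 0 from ?_, map_zero]
    refine LinearMap.ext fun v => ?_
    rw [LinearMap.comp_apply, LinearMap.comp_apply, h2, preAct_single]
    by_cases hb : (m * (repOfTop σ).1).bot = π
    · rw [dif_pos hb, preCoordinate_single, dif_neg (fun ht => h ⟨hb, ht⟩)]
      rfl
    · rw [dif_neg hb, map_zero]
      rfl

end Induced

/-! ### The factorization of the character table -/

section Factorization

variable {k : ℕ}

/-- A union of blocks of `d` is also one for `c`, and its bottom half determines its top half in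
either diagram. So multiplying `c` by the idempotent keeps exactly the unions of blocks of `d`. -/
theorem mul_idem_top_eq {c d : U k} (hle : c.rel ≤ d.rel) (h : d.bot = d.top) :
    c * idem d.top = d := by
  refine U.ext_sat fun S T => ?_
  have hcd : ∀ S, Sat d.rel S T → Sat c.rel S T := fun S hs x y hxy => hs x y (hle hxy)
  rw [sat_mul]
  simp only [sat_idem]
  constructor
  · rintro ⟨M, hM, rfl, hT⟩
    rw [← h] at hT
    obtain ⟨S', hS'⟩ := (sat_bot d M).2 hT
    rw [((sat_iff _ _ _).1 hM).1, ← ((sat_iff _ _ _).1 (hcd _ hS')).1]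
    exact hS'
  · intro hs
    exact ⟨T, hcd S hs, rfl, h ▸ (sat_bot d T).1 ⟨S, hs⟩⟩

theorem rel_le_mul_idem (c : U k) (σ : Setoid (Fin k)) : c.rel ≤ (c * idem σ).rel := by
  intro x y hxy
  let r := (c * idem σ).rel
  have e : Sum.elim (fun a => r x (Sum.inl a)) (fun b => r x (Sum.inr b)) = r x := by
    funext p
    rcases p with p | p <;> rfl
  have hs : Sat r (fun a => r x (Sum.inl a)) (fun b => r x (Sum.inr b)) := by
    intro p q hpq
    rw [e]
    exact ⟨fun hp => r.trans' hp hpq, fun hq => r.trans' hq (r.symm' hpq)⟩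
  obtain ⟨M, h1, h2⟩ := (sat_mul _ _ _ _).1 hs
  obtain ⟨rfl, -⟩ := (sat_idem _ _ _).1 h2
  have h3 := h1 x y hxy
  rw [e] at h3
  exact h3.1 (r.refl' x)

theorem cycleType_unique {c d : U k} {n n' : I k} (h : d ∈ mergings c n) (h' : d ∈ mergings c n') :
    n = n' := by
  obtain ⟨-, _, h1⟩ := h
  obtain ⟨-, _, h2⟩ := h'
  exact Subtype.ext (h1.symm.trans h2)

theorem exists_type_eq (a : ExpPtn k) (g : G (repPartition a)) :
    ∃ n : I k, cycleType g = n.1 ∧ type n = a := by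
  have h1 : ∀ i, (cycleType g i).1 = a.1 i := by
    intro i
    exact (Fintype.card_congr (labelEquiv (isLabelling_blockOf a) i)).symm.trans (Fintype.card_fin _)
  have h2 : (fun i => (cycleType g i).1) = a.1 := funext h1
  refine ⟨⟨cycleType g, ?_⟩, rfl, Subtype.ext h2⟩
  simp only [h1]
  exact a.2

/-- With `g` the ratio, `c e_σ = l g l⁻¹` where `σ = top l`. Carrying a labelling for `g` from the
bottom of `l` to its top shows that conjugation by `l` keeps the cycle type. -/
theorem mem_mergings_of_ratio {c : U k} {π : Setoid (Fin k)} {n : I k} (l : L π)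
    (hb : (c * l.1).bot = π) (ht : (c * l.1).top = l.1.top)
    (hn : cycleType (ratio l ⟨c * l.1, hb⟩ ht) = n.1) : c * idem l.1.top ∈ mergings c n := by
  obtain ⟨f, hf, hg⟩ := (cycleType_eq_iff _).1 hn
  have hker : l.1.bot = Setoid.ker f := by
    rw [l.2, ← (ratio l ⟨c * l.1, hb⟩ ht).2.2, U.bot, hg]
    rfl
  obtain ⟨f', hf'⟩ := exists_rel_eq_ker l.1 hker
  have hfl : IsLabelling f' := fun w => (ncard_fiber_eq hf' w).trans (hf w)
  refine mem_mergings_iff.2 ⟨rel_le_mul_idem _ _, f', hfl, ?_⟩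
  have h1 : c * idem l.1.top = l.1 * (ratio l ⟨c * l.1, hb⟩ ht).1 * flip l.1 := by
    change _ = l.1 * (flip l.1 * (c * l.1)) * flip l.1
    rw [← mul_assoc l.1, mul_flip, ← ht, idem_mul, mul_assoc, mul_flip, ht]
  rw [h1]
  -- The labels of `l` are permuted simultaneously on both rows, which does not change `l`, to match
  -- the top labels of `g`.
  have h2 : l.1.rel = Setoid.ker (Sum.elim (repBlockPerm n ∘ f') (repBlockPerm n ∘ f)) := by
    rw [ker_elim_comp (repBlockPerm n).injective, hf']
  exact rel_mul_eq_ker hf.surjective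
    (rel_mul_eq_ker ((repBlockPerm n).surjective.comp hf.surjective) h2 hg) (rel_flip_eq_ker hf')

/-- Joining each block of `top d` to the interval with the same label gives the required element of
the `𝓛`-class. -/
theorem exists_top_eq {c d : U k} {n : I k} (h : d ∈ mergings c n) :
    ∃ l : L (repPartition (type n)), l.1.top = d.top := by
  obtain ⟨-, f, hf, hd⟩ := mem_mergings_iff.1 h
  refine ⟨⟨ofLabels f (blockOf (type n)) fun w => (hf w).trans (isLabelling_blockOf _ w).symm, rfl⟩,
    ?_⟩
  ext x y
  rw [U.top, U.top, hd]
  exact (repBlockPerm n).injective.eq_iff.symm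

theorem A_eq_zero {l n : I k} (h : type l ≠ type n) : A k l n = 0 := dif_neg (Ne.symm h)

theorem A_eq_character {l n : I k} (h : type n = type l) (g : G (repPartition (type l)))
    (hg : cycleType g = n.1) : A k l n = (groupRep (repPartition (type l)) l).character g := by
  unfold A
  rw [dif_pos h]
  exact character_groupRep_eq l ((cycleType_rep n _).trans hg.symm)

/-- The sum over `σ` in the induced character is matched with the mergings of `rep m` whose type is
that of `l`: a merging `d` belongs to `σ = top d`, and its term depends only on its cycle type. -/
theorem X_apply (l m : I k) :
    X k l m = ∑ n, A k l n * ((mergings (rep m) n).ncard : ℂ) := by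
  let S : Finset (I k × U k) :=
    (Set.toFinite {x : I k × U k | type x.1 = type l ∧ x.2 ∈ mergings (rep m) x.1}).toFinset
  have hS : ∀ x, x ∈ S ↔ type x.1 = type l ∧ x.2 ∈ mergings (rep m) x.1 := fun x =>
    Set.Finite.mem_toFinset _
  have hmerge : ∀ {d : U k} {n : I k}, d ∈ mergings (rep m) n → rep m * idem d.top = d :=
    fun hd => mul_idem_top_eq hd.1 hd.2.choose
  have h1 : X k l m = ∑ σ : Tops (repPartition (type l)), ∑ x ∈ S,
      if x.2.top = σ.1 then A k l x.1 else 0 := by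
    refine (character_indRep _ _).trans (Finset.sum_congr rfl fun σ _ => ?_)
    have hσ := top_repOfTop σ
    split_ifs with h
    · obtain ⟨n, hn, htype⟩ := exists_type_eq (type l)
        (ratio (repOfTop σ) ⟨rep m * (repOfTop σ).1, h.1⟩ h.2)
      have hmem := mem_mergings_of_ratio _ _ _ hn
      rw [top_repOfTop] at hmem
      -- `c e_σ = (c ℓ_σ) ℓ_σ⁻¹` has the same top as `c ℓ_σ`, which is `σ`.
      have htop : (rep m * idem σ.1).top = σ.1 := by
        have h3 : rep m * idem σ.1 = (rep m * (repOfTop σ).1) * flip (repOfTop σ).1 := by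
          rw [mul_assoc, mul_flip, top_repOfTop]
        rw [h3, top_mul (e := flip (repOfTop σ).1) (h.1.trans (repOfTop σ).2.symm), h.2, hσ]
      rw [Finset.sum_eq_single (n, rep m * idem σ.1)]
      · rw [if_pos htop]
        exact (A_eq_character htype _ hn).symm
      · rintro ⟨n', d⟩ hx hne
        rw [if_neg]
        rintro hd
        obtain ⟨-, hx⟩ := (hS _).1 hx
        have h4 := hmerge hx
        rw [show d.top = σ.1 from hd] at h4
        refine hne (Prod.ext (cycleType_unique hx ?_) h4.symm)
        rw [← show rep m * idem σ.1 = d from h4]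
        exact hmem
      · intro hx
        exact absurd ((hS _).2 ⟨htype, hmem⟩) hx
    · refine (Finset.sum_eq_zero fun x hx => if_neg fun hd => h ?_).symm
      obtain ⟨-, hx⟩ := (hS _).1 hx
      -- A merging `d` with top `σ` would act on `ℓ_σ` as `rep m` does and keep it in its class, so
      -- a vanishing term has no merging.
      have h4 : rep m * (repOfTop σ).1 = x.2 * (repOfTop σ).1 := by
        conv_rhs => rw [← hmerge hx, hd, ← top_repOfTop σ, mul_assoc, idem_mul]
      have h5 : x.2.bot = (repOfTop σ).1.top := by
        rw [hx.2.choose, hd, top_repOfTop]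
      rw [h4, top_mul h5, bot_mul h5]
      exact ⟨(repOfTop σ).2, hd.trans hσ.symm⟩
  rw [h1, Finset.sum_comm]
  -- Each merging is counted for exactly one `σ`, namely its top, which does occur in the `𝓛`-class.
  have h2 : ∀ x ∈ S, (∑ σ : Tops (repPartition (type l)),
      if x.2.top = σ.1 then A k l x.1 else 0) = A k l x.1 := by
    intro x hx
    obtain ⟨htype, hx⟩ := (hS _).1 hx
    have h3 := exists_top_eq hx
    rw [htype] at h3
    rw [Finset.sum_eq_single (⟨x.2.top, h3⟩ : Tops (repPartition (type l)))]
    · exact if_pos rfl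
    · intro σ _ hne
      exact if_neg fun h => hne (Subtype.ext h.symm)
    · simp
  rw [Finset.sum_congr rfl h2, ← Finset.sum_fiberwise S Prod.fst]
  refine Finset.sum_congr rfl fun n _ => ?_
  rw [Finset.sum_congr rfl (g := fun _ => A k l n)
    (fun x hx => by rw [(Finset.mem_filter.1 hx).2]), Finset.sum_const, nsmul_eq_mul, mul_comm]
  by_cases hn : type n = type l
  · congr 2
    rw [Set.ncard_eq_toFinset_card _ (Set.toFinite _)]
    refine Finset.card_bij (fun x _ => x.2) ?_ ?_ ?_
    · intro x hx
      obtain ⟨hxS, rfl⟩ := Finset.mem_filter.1 hx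
      exact (Set.Finite.mem_toFinset _).2 ((hS x).1 hxS).2
    · intro x hx y hy hxy
      exact Prod.ext ((Finset.mem_filter.1 hx).2.trans (Finset.mem_filter.1 hy).2.symm) hxy
    · intro d hd
      exact ⟨(n, d), Finset.mem_filter.2 ⟨(hS _).2 ⟨hn, (Set.Finite.mem_toFinset _).1 hd⟩, rfl⟩, rfl⟩
  · rw [A_eq_zero (Ne.symm hn), zero_mul, zero_mul]

theorem X_eq_A_mul_B (k : ℕ) : X k = A k * B k := by
  ext l m
  rw [Matrix.mul_apply, X_apply]
  simp only [B_eq_ncard_mergings]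

end Factorization

end

end UBP

theorem mainTheorem7 (k : ℕ) :
    (∀ l m : UBP.I k, UBP.type l ≠ UBP.type m → UBP.A k l m = 0) ∧
    (UBP.B k).BlockTriangular id ∧
    (∀ n : UBP.I k, UBP.B k n n = 1) ∧
    (∀ n m : UBP.I k, ∃ b : ℕ, UBP.B k n m = b) ∧
    (∀ n m : UBP.I k, UBP.B k n m = ((UBP.mergings (UBP.rep m) n).ncard : ℂ)) ∧
    UBP.X k = UBP.A k * UBP.B k :=
  ⟨fun _ _ => UBP.A_eq_zero, UBP.B_blockTriangular k, UBP.B_self,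
    fun n m => ⟨_, UBP.B_eq_ncard_mergings n m⟩, UBP.B_eq_ncard_mergings, UBP.X_eq_A_mul_B k⟩
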